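/- Let $\mathbb{S}^2\subset\mathbb{R}^3$ be the unit sphere with its round metric, let $\Delta$ be its Laplace--Beltrami operator, and let $\|\cdot\|_\infty$ be the norm of $L^\infty(\mathbb{S}^2,\mathbb{C})$ with respect to the surface measure. There exist a constant $C>0$ and an integer $N_0$ such that, for every integer $N\ge N_0$ and every point $P\in\mathbb{S}^2$ with antipodal point $Q=-P$, there exist a function $W\in L^\infty(\mathbb{S}^2,\mathbb{C})$ with $$N\ \ge\ C\,\|W\|_\infty^{2/3}$$ and a function $u\in\mathcal{C}^2(\mathbb{S}^2,\mathbb{C})$ solving $$\Delta u+Wu=0\quad\text{on }\mathbb{S}^2$$ that vanishes at $P$ with order exactly $N$, that is, $u(x)=O(d(x,P)^N)$ but $u(x)\neq o(d(x,P)^N)$ as $x\to P$. Moreover, $W$ can be chosen with compact support $\operatorname{supp}W\subset\mathbb{S}^2\setminus\{P,Q\}$. -/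

import Mathlib

open MeasureTheory Asymptotics Topology
open scoped Manifold ContDiff

noncomputable section

/-- Euclidean three-space. -/
abbrev E3 : Type := EuclideanSpace ℝ (Fin 3)

/-- The unit sphere `S²` of Euclidean three-space. -/
abbrev S2 : Type := Metric.sphere (0 : E3) 1

/-- The surface measure of the round sphere (total mass `4π`). -/
def surfaceMeasure : Measure S2 := (volume : Measure E3).toSphere

/-- The degree-zero homogeneous extension `y ↦ u (y / ‖y‖)` of a function on the sphere to
`ℝ³ ∖ {0}` (with the irrelevant value `0` at the origin). -/
def homogExt (u : S2 → ℂ) (y : E3) : ℂ :=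
  open Classical in
  if hy : y = 0 then 0
  else u ⟨‖y‖⁻¹ • y, by
    rw [mem_sphere_zero_iff_norm, norm_smul, norm_inv, norm_norm]
    exact inv_mul_cancel₀ (norm_ne_zero_iff.mpr hy)⟩

/-- The Laplace-Beltrami operator of the round sphere `S²` on `C²` functions: the restriction to
the sphere of the Euclidean Laplacian of the degree-zero homogeneous extension. (Sign convention:
the sum of the second derivatives, so that the operator is nonpositive.) -/
def sphereLaplacian (u : S2 → ℂ) (x : S2) : ℂ :=
  Laplacian.laplacian (homogExt u) (x : E3)

/-- `u` vanishes with order (exactly) `N` at `P`: `u(x) = O(d(x, P)^N)` as `x → P`, but not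
`u(x) = o(d(x, P)^N)`. The distance is the chordal one, which is comparable to the
geodesic distance. In particular `u` is not identically zero near `P`. -/
def VanishesWithOrder (u : S2 → ℂ) (P : S2) (N : ℕ) : Prop :=
  (u =O[𝓝 P] fun x => dist x P ^ N) ∧ ¬ (u =o[𝓝 P] fun x => dist x P ^ N)

end

/-!
Away from `±P` the sphere is conformal to the cylinder with coordinate `w = t + iθ`, where `e^w` is
the stereographic coordinate centred at `P`; the Laplacian of the sphere is a positive factor, which
is bounded on bounded ranges of `t`, times the flat one. So it suffices to find, with constants
independent of `N`, a `2πi`-periodic function `U` with `|ΔU| ≤ A N^{3/2} |U|` that equals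
`e^{Nt - iNθ}` for `t ≤ 0` and a bounded harmonic mode `c e^{-|j|t + ijθ}` for `t ≥ 10`
(`HasBridge`, `exists_bridge`). The two ends correspond to a zero of order `N` at `P` and to a
harmonic function near `-P`, and the potential is `-Δu/u`, with value `0` at the zeros of `u`.

The exponent is lowered in the manner of Meshkov. Put `k ≈ √N`. On a strip of width `O(1/k)` the
function `e^{nt - inθ}` is turned into a multiple of `e^{(n-2k)(t + iθ)}` (`exists_transition`). The
number of zeros which this forces is `2n - 2k`. In the middle of the strip the function is
`e^{nt - inθ} (1 - e^{2kt} (y + α y²))` with `y = e^{i(2n-2k)θ}`, and `α = O(k/n)` is chosen so that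
its Laplacian is `-8nk e^{(n+2k)t - inθ} (y - y²)`. All zeros of the function have `y = 1`, where
the Laplacian vanishes as well, and the function dominates because
`|1 - y| ≤ 8 |r - (y + α y²)|` for all `r > 0` (`norm_one_sub_le_of_pos`). In the rest of the strip
one term dominates the others and cutoffs cost only a factor `O(nk)` (`exists_transition_bound`).
After a transition the angular frequency has changed sign, so the next one is applied to the complex
conjugate (`HasBridge.transition`). After `O(√N)` transitions, of total length `O(1)`, the exponent
is `O(k)`, and a radial cutoff turns `e^{nt}` into `e^{-nt}` (`exists_bridge_base`). Throughout,
`nk ≤ k³ = O(N^{3/2})`.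
-/

/-! ### Second derivatives and the Laplacian under conformal maps -/

open Laplacian in
theorem laplacian_eq_sum_fderiv {ι E F : Type*} [Fintype ι] [NormedAddCommGroup E]
    [InnerProductSpace ℝ E] [FiniteDimensional ℝ E] [NormedAddCommGroup F] [NormedSpace ℝ F]
    (b : OrthonormalBasis ι ℝ E) (f : E → F) (x : E) :
    laplacian f x = ∑ i, fderiv ℝ (fderiv ℝ f) x (b i) (b i) := by
  rw [InnerProductSpace.laplacian_eq_iteratedFDeriv_orthonormalBasis f b]
  simp [iteratedFDeriv_two_apply]

open Laplacian in
theorem laplacian_complex_eq_fderiv {F : Type*} [NormedAddCommGroup F] [NormedSpace ℝ F]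
    (f : ℂ → F) (z : ℂ) :
    laplacian f z = fderiv ℝ (fderiv ℝ f) z 1 1 +
      fderiv ℝ (fderiv ℝ f) z Complex.I Complex.I := by
  rw [InnerProductSpace.laplacian_eq_iteratedFDeriv_complexPlane f]
  simp [iteratedFDeriv_two_apply]

theorem ContDiffAt.differentiableAt_fderiv_of_two {E F : Type*} [NormedAddCommGroup E]
    [NormedSpace ℝ E] [NormedAddCommGroup F] [NormedSpace ℝ F] {f : E → F} {x : E}
    (hf : ContDiffAt ℝ 2 f x) : DifferentiableAt ℝ (fderiv ℝ f) x :=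
  (hf.fderiv_right (m := 1) (by norm_num)).differentiableAt (by norm_num)

theorem ContDiffAt.eventually_differentiableAt_of_two {E F : Type*} [NormedAddCommGroup E]
    [NormedSpace ℝ E] [NormedAddCommGroup F] [NormedSpace ℝ F] {f : E → F} {x : E}
    (hf : ContDiffAt ℝ 2 f x) : ∀ᶠ y in 𝓝 x, DifferentiableAt ℝ f y := by
  filter_upwards [hf.eventually (by simp)] with y hy
  exact hy.differentiableAt (by norm_num)

/-- The second derivative in a direction `v` can be computed along the line through `x`. -/
theorem fderiv_fderiv_eq_of_line {E F : Type*} [NormedAddCommGroup E]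
    [NormedSpace ℝ E] [NormedAddCommGroup F] [NormedSpace ℝ F] {f : E → F} {x v : E}
    {g' : ℝ → F} {g'' : F} (hf : ContDiffAt ℝ 2 f x)
    (h1 : ∀ᶠ s in 𝓝 (0 : ℝ), HasDerivAt (fun s : ℝ => f (x + s • v)) (g' s) s)
    (h2 : HasDerivAt g' g'' 0) :
    fderiv ℝ (fderiv ℝ f) x v v = g'' := by
  have hline : ∀ s : ℝ, HasDerivAt (fun s : ℝ => x + s • v) v s := fun s => by
    simpa using ((hasDerivAt_id s).smul_const v).const_add x
  have htend : Filter.Tendsto (fun s : ℝ => x + s • v) (𝓝 0) (𝓝 x) := by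
    have := (hline 0).continuousAt.tendsto
    simpa using this
  have heq : g' =ᶠ[𝓝 0] fun s => fderiv ℝ f (x + s • v) v := by
    filter_upwards [h1, htend.eventually hf.eventually_differentiableAt_of_two] with s hs hd
    exact hs.unique (hd.hasFDerivAt.comp_hasDerivAt s (hline s))
  have hd := hf.differentiableAt_fderiv_of_two.hasFDerivAt
  have hd' : HasFDerivAt (fderiv ℝ f) (fderiv ℝ (fderiv ℝ f) x) (x + (0 : ℝ) • v) := by
    rw [zero_smul, add_zero]
    exact hd
  have h3 : HasDerivAt (fun s : ℝ => fderiv ℝ f (x + s • v) v)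
      (fderiv ℝ (fderiv ℝ f) x v v) 0 := by
    exact (ContinuousLinearMap.apply ℝ F v).hasFDerivAt.comp_hasDerivAt (0 : ℝ)
      (hd'.comp_hasDerivAt (0 : ℝ) (hline 0))
  exact (h3.congr_of_eventuallyEq heq).unique h2

theorem fderiv_eq_of_line {E F : Type*} [NormedAddCommGroup E]
    [NormedSpace ℝ E] [NormedAddCommGroup F] [NormedSpace ℝ F] {f : E → F} {x v : E}
    {g' : F} (hf : DifferentiableAt ℝ f x)
    (h1 : HasDerivAt (fun s : ℝ => f (x + s • v)) g' 0) :
    fderiv ℝ f x v = g' := by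
  have hline : HasDerivAt (fun s : ℝ => x + s • v) v 0 := by
    simpa using ((hasDerivAt_id (0 : ℝ)).smul_const v).const_add x
  have hd' : HasFDerivAt f (fderiv ℝ f x) (x + (0 : ℝ) • v) := by
    simpa using hf.hasFDerivAt
  exact (hd'.comp_hasDerivAt (0 : ℝ) hline).unique h1

theorem fderiv_fderiv_comp {E F G : Type*} [NormedAddCommGroup E]
    [NormedSpace ℝ E] [NormedAddCommGroup F] [NormedSpace ℝ F] [NormedAddCommGroup G]
    [NormedSpace ℝ G] {φ : E → F} {V : F → G} {x : E} (hφ : ContDiffAt ℝ 2 φ x)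
    (hV : ContDiffAt ℝ 2 V (φ x)) (v : E) :
    fderiv ℝ (fderiv ℝ (V ∘ φ)) x v v =
      fderiv ℝ (fderiv ℝ V) (φ x) (fderiv ℝ φ x v) (fderiv ℝ φ x v) +
        fderiv ℝ V (φ x) (fderiv ℝ (fderiv ℝ φ) x v v) := by
  have heq : fderiv ℝ (V ∘ φ) =ᶠ[𝓝 x] fun y => (fderiv ℝ V (φ y)).comp (fderiv ℝ φ y) := by
    filter_upwards [hφ.eventually_differentiableAt_of_two,
      hφ.continuousAt.eventually hV.eventually_differentiableAt_of_two] with y h1 h2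
    exact fderiv_comp y h2 h1
  have hd : HasFDerivAt φ (fderiv ℝ φ x) x := (hφ.differentiableAt (by norm_num)).hasFDerivAt
  have h1 := hV.differentiableAt_fderiv_of_two.hasFDerivAt.comp x hd
  have h2 := h1.clm_comp hφ.differentiableAt_fderiv_of_two.hasFDerivAt
  have h3 := h2.congr_of_eventuallyEq heq
  rw [h3.fderiv]
  simp [add_comm]

open Laplacian in
/-- Chain rule for a map into the plane which is conformal to first order at `x` (with conformal
factor `lam`) and has vanishing Laplacian at `x`. -/
theorem laplacian_comp_of_conformal {ι E : Type*} [Fintype ι] [NormedAddCommGroup E]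
    [InnerProductSpace ℝ E] [FiniteDimensional ℝ E] (b : OrthonormalBasis ι ℝ E)
    {φ : E → ℂ} {V : ℂ → ℂ} {x : E} {lam : ℝ} (hφ : ContDiffAt ℝ 2 φ x)
    (hV : ContDiffAt ℝ 2 V (φ x))
    (hharm : ∑ i, fderiv ℝ (fderiv ℝ φ) x (b i) (b i) = 0)
    (hre : ∑ i, (fderiv ℝ φ x (b i)).re ^ 2 = lam)
    (him : ∑ i, (fderiv ℝ φ x (b i)).im ^ 2 = lam)
    (hri : ∑ i, (fderiv ℝ φ x (b i)).re * (fderiv ℝ φ x (b i)).im = 0) :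
    laplacian (V ∘ φ) x = lam * laplacian V (φ x) := by
  rw [laplacian_eq_sum_fderiv b, laplacian_complex_eq_fderiv]
  simp_rw [fderiv_fderiv_comp hφ hV]
  rw [Finset.sum_add_distrib, ← map_sum, hharm, map_zero, add_zero]
  set H := fderiv ℝ (fderiv ℝ V) (φ x)
  have key : ∀ z : ℂ, H z z = ((z.re ^ 2 : ℝ) : ℂ) * H 1 1 + ((z.im ^ 2 : ℝ) : ℂ) *
      H Complex.I Complex.I + ((z.re * z.im : ℝ) : ℂ) * (H 1 Complex.I + H Complex.I 1) := by
    intro z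
    have hz : z = z.re • (1 : ℂ) + z.im • Complex.I := by
      apply Complex.ext <;> simp
    conv_lhs => rw [hz]
    simp only [map_add, map_smul, add_apply, smul_apply]
    simp only [Complex.real_smul]
    push_cast
    ring
  rw [Finset.sum_congr rfl fun i _ => key _, Finset.sum_add_distrib, Finset.sum_add_distrib,
    ← Finset.sum_mul, ← Finset.sum_mul, ← Finset.sum_mul, ← Complex.ofReal_sum,
    ← Complex.ofReal_sum, ← Complex.ofReal_sum,
    hre, him, hri]
  push_cast
  ring

open Laplacian in
theorem laplacian_comp_of_analyticAt {h V : ℂ → ℂ} {z : ℂ} (hh : AnalyticAt ℂ h z)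
    (hV : ContDiffAt ℝ 2 V (h z)) :
    laplacian (V ∘ h) z = (‖deriv h z‖ ^ 2 : ℝ) * laplacian V (h z) := by
  have hd : fderiv ℝ h z = (ContinuousLinearMap.toSpanSingleton ℂ (deriv h z)).restrictScalars ℝ :=
    (hh.differentiableAt.hasDerivAt.hasFDerivAt.restrictScalars ℝ).fderiv
  have h2 : ContDiffAt ℝ 2 h z := (hh.contDiffAt (n := 2)).restrict_scalars ℝ
  have h3 : laplacian h z = 0 := hh.harmonicAt.2.eq_of_nhds
  rw [laplacian_eq_sum_fderiv Complex.orthonormalBasisOneI] at h3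
  refine laplacian_comp_of_conformal Complex.orthonormalBasisOneI h2 hV h3 ?_ ?_ ?_ <;>
    simp [hd, ← Complex.normSq_eq_norm_sq, Complex.normSq_apply] <;> ring

open Laplacian in
theorem laplacian_eq_zero_of_analyticAt {h : ℂ → ℂ} {z : ℂ} (hh : AnalyticAt ℂ h z) :
    laplacian h z = 0 := hh.harmonicAt.2.eq_of_nhds

open Laplacian ComplexConjugate in
theorem laplacian_conj_comp {h : ℂ → ℂ} {z : ℂ} (hh : ContDiffAt ℝ 2 h z) :
    laplacian (fun w => conj (h w)) z = conj (laplacian h z) :=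
  hh.laplacian_CLM_comp_left (l := (Complex.conjCLE : ℂ →L[ℝ] ℂ))

open Laplacian in
theorem laplacian_const_mul {h : ℂ → ℂ} {z : ℂ} (c : ℂ) (hh : ContDiffAt ℝ 2 h z) :
    laplacian (fun w => c * h w) z = c * laplacian h z :=
  InnerProductSpace.laplacian_smul c hh

open Laplacian in
theorem laplacian_comp_sub_const {h : ℂ → ℂ} {z : ℂ} (c : ℂ) (hh : ContDiffAt ℝ 2 h (z - c)) :
    laplacian (fun w => h (w - c)) z = laplacian h (z - c) := by
  have h1 : AnalyticAt ℂ (fun w : ℂ => w - c) z := by fun_prop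
  have := laplacian_comp_of_analyticAt h1 (V := h) hh
  simpa [Function.comp_def] using this

/-- The cylindrical mode `a(t) e^{i l θ}` in the coordinate `w = t + iθ`. -/
noncomputable def cylMode (a : ℝ → ℝ) (l : ℝ) (w : ℂ) : ℂ :=
  (a w.re : ℂ) * Complex.exp ((l * w.im : ℝ) * Complex.I)

theorem contDiff_cylMode {a : ℝ → ℝ} (ha : ContDiff ℝ 2 a) (l : ℝ) :
    ContDiff ℝ 2 (cylMode a l) := by
  have hre : ContDiff ℝ 2 Complex.re := Complex.reCLM.contDiff
  have him : ContDiff ℝ 2 Complex.im := Complex.imCLM.contDiff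
  have hof : ContDiff ℝ 2 (fun x : ℝ => (x : ℂ)) := Complex.ofRealCLM.contDiff
  have hexp : ContDiff ℝ 2 Complex.exp := Complex.contDiff_exp
  unfold cylMode
  refine (hof.comp (ha.comp hre)).mul (hexp.comp ((hof.comp ?_).mul contDiff_const))
  exact contDiff_const.mul him

open Laplacian in
theorem laplacian_cylMode {a a' : ℝ → ℝ} {a'' : ℝ} {l : ℝ} (ha : ContDiff ℝ 2 a) {w : ℂ}
    (h1 : ∀ t, HasDerivAt a (a' t) t) (h2 : HasDerivAt a' a'' w.re) :
    laplacian (cylMode a l) w =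
      ((a'' - l ^ 2 * a w.re : ℝ) : ℂ) * Complex.exp ((l * w.im : ℝ) * Complex.I) := by
  have hC : ContDiffAt ℝ 2 (cylMode a l) w := (contDiff_cylMode ha l).contDiffAt
  rw [laplacian_complex_eq_fderiv]
  set e := Complex.exp ((l * w.im : ℝ) * Complex.I) with he
  have hadd : ∀ s : ℝ, HasDerivAt (fun s : ℝ => w.re + s) 1 s := fun s => by
    simpa using (hasDerivAt_id s).const_add w.re
  have e1 : fderiv ℝ (fderiv ℝ (cylMode a l)) w 1 1 = (a'' : ℂ) * e := by
    refine fderiv_fderiv_eq_of_line (g' := fun s => (a' (w.re + s) : ℂ) * e) hC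
      (Filter.Eventually.of_forall fun s => ?_) ?_
    · have : HasDerivAt (fun s : ℝ => a (w.re + s)) (a' (w.re + s)) s := by
        simpa using! (h1 (w.re + s)).comp s (hadd s)
      simpa [cylMode, he] using this.ofReal_comp.mul_const e
    · have : HasDerivAt (fun s : ℝ => a' (w.re + s)) a'' 0 := by
        have h2' : HasDerivAt a' a'' (w.re + 0) := by simpa using h2
        simpa using! h2'.comp 0 (hadd 0)
      exact this.ofReal_comp.mul_const e
  have hexp : ∀ s : ℝ, HasDerivAt (fun s : ℝ => Complex.exp ((l * (w.im + s) : ℝ) * Complex.I))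
      (Complex.exp ((l * (w.im + s) : ℝ) * Complex.I) * (l * Complex.I)) s := fun s => by
    have h3 : HasDerivAt (fun s : ℝ => l * (w.im + s)) l s := by
      simpa using ((hasDerivAt_id s).const_add w.im).const_mul l
    exact (h3.ofReal_comp.mul_const Complex.I).cexp
  have e2 : fderiv ℝ (fderiv ℝ (cylMode a l)) w Complex.I Complex.I =
      -(l ^ 2 * a w.re : ℂ) * e := by
    refine fderiv_fderiv_eq_of_line (g' := fun s => (a w.re : ℂ) *
      (Complex.exp ((l * (w.im + s) : ℝ) * Complex.I) * (l * Complex.I))) hC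
      (Filter.Eventually.of_forall fun s => ?_) ?_
    · simpa [cylMode] using (hexp s).const_mul (a w.re : ℂ)
    · have := ((hexp 0).mul_const (l * Complex.I : ℂ)).const_mul (a w.re : ℂ)
      convert! this using 1
      simp only [add_zero, ← he]
      linear_combination (-(l ^ 2 * a w.re * e : ℂ)) * (Complex.I_sq)
  rw [e1, e2]
  push_cast
  ring

/-! ### Radial profiles and modulated modes -/

/-- Smooth cutoff equal to `1` for `s ≤ 1` and to `0` for `s ≥ 2`. -/
noncomputable def fadeOut (s : ℝ) : ℝ := 1 - Real.smoothTransition (s - 1)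

/-- Smooth cutoff equal to `0` for `s ≤ -2` and to `1` for `s ≥ -1`. -/
noncomputable def fadeIn (s : ℝ) : ℝ := Real.smoothTransition (s + 2)

/-- Smooth positive function equal to `e^{2s}` for `s ≤ 1` and to `e^{6-2s}` for `s ≥ 2`. -/
noncomputable def bend (s : ℝ) : ℝ :=
  fadeOut s * Real.exp (2 * s) + (1 - fadeOut s) * Real.exp (6 - 2 * s)

theorem contDiff_fadeOut : ContDiff ℝ 2 fadeOut :=
  contDiff_const.sub (Real.smoothTransition.contDiff.comp (contDiff_id.sub contDiff_const))

theorem contDiff_fadeIn : ContDiff ℝ 2 fadeIn :=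
  Real.smoothTransition.contDiff.comp (contDiff_id.add contDiff_const)

theorem contDiff_bend : ContDiff ℝ 2 bend := by
  have h := contDiff_fadeOut
  unfold bend
  fun_prop

theorem fadeOut_nonneg (s : ℝ) : 0 ≤ fadeOut s :=
  sub_nonneg.2 (Real.smoothTransition.le_one _)

theorem fadeOut_le_one (s : ℝ) : fadeOut s ≤ 1 :=
  sub_le_self _ (Real.smoothTransition.nonneg _)

theorem fadeIn_nonneg (s : ℝ) : 0 ≤ fadeIn s := Real.smoothTransition.nonneg _

theorem fadeIn_le_one (s : ℝ) : fadeIn s ≤ 1 := Real.smoothTransition.le_one _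

theorem fadeOut_of_le {s : ℝ} (h : s ≤ 1) : fadeOut s = 1 := by
  rw [fadeOut, Real.smoothTransition.zero_of_nonpos (by linarith), sub_zero]

theorem fadeOut_of_ge {s : ℝ} (h : 2 ≤ s) : fadeOut s = 0 := by
  rw [fadeOut, Real.smoothTransition.one_of_one_le (by linarith), sub_self]

theorem fadeIn_of_le {s : ℝ} (h : s ≤ -2) : fadeIn s = 0 :=
  Real.smoothTransition.zero_of_nonpos (by linarith)

theorem fadeIn_of_ge {s : ℝ} (h : -1 ≤ s) : fadeIn s = 1 :=
  Real.smoothTransition.one_of_one_le (by linarith)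

theorem bend_of_le {s : ℝ} (h : s ≤ 1) : bend s = Real.exp (2 * s) := by
  simp [bend, fadeOut_of_le h]

theorem bend_of_ge {s : ℝ} (h : 2 ≤ s) : bend s = Real.exp (6 - 2 * s) := by
  simp [bend, fadeOut_of_ge h]

theorem three_le_bend {s : ℝ} (h1 : 1 ≤ s) (h2 : s ≤ 2) : 3 ≤ bend s := by
  have e1 : 3 ≤ Real.exp (2 * s) := by linarith [Real.add_one_le_exp (2 * s)]
  have e2 : 3 ≤ Real.exp (6 - 2 * s) := by linarith [Real.add_one_le_exp (6 - 2 * s)]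
  unfold bend
  nlinarith [fadeOut_nonneg s, fadeOut_le_one s]

/-- Profile, relative to `e^{nt}`, of the mode with frequency `n - 2k` that remains after the
transition. -/
noncomputable def midProfile (s : ℝ) : ℝ := fadeIn s * bend s

/-- Profile, relative to `e^{nt}`, of the correcting mode with frequency `3n - 4k`, which is present
only during the transition. -/
noncomputable def corrProfile (s : ℝ) : ℝ := fadeOut s * (fadeIn s * bend s)

theorem contDiff_midProfile : ContDiff ℝ 2 midProfile := contDiff_fadeIn.mul contDiff_bend

theorem contDiff_corrProfile : ContDiff ℝ 2 corrProfile := contDiff_fadeOut.mul contDiff_midProfile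

theorem exists_bound_derivs {f : ℝ → ℝ} (hf : ContDiff ℝ 2 f) (a b : ℝ) :
    ∃ B : ℝ, 0 ≤ B ∧ ∀ s ∈ Set.Icc a b, |f s| ≤ B ∧ |deriv f s| ≤ B ∧ |deriv (deriv f) s| ≤ B := by
  have h1 : ContDiff ℝ 1 (deriv f) := by
    have : ContDiff ℝ (1 + 1) f := by simpa [one_add_one_eq_two] using hf
    exact (contDiff_succ_iff_deriv.1 this).2.2
  have h2 : Continuous (deriv (deriv f)) := h1.continuous_deriv (by norm_num)
  obtain ⟨B0, hB0⟩ := isCompact_Icc.exists_bound_of_continuousOn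
    (hf.continuous.continuousOn (s := Set.Icc a b))
  obtain ⟨B1, hB1⟩ := isCompact_Icc.exists_bound_of_continuousOn
    (h1.continuous.continuousOn (s := Set.Icc a b))
  obtain ⟨B2, hB2⟩ := isCompact_Icc.exists_bound_of_continuousOn
    (h2.continuousOn (s := Set.Icc a b))
  refine ⟨|B0| + |B1| + |B2|, by positivity, fun s hs => ⟨?_, ?_, ?_⟩⟩
  · have := hB0 s hs
    rw [Real.norm_eq_abs] at this
    linarith [le_abs_self B0, abs_nonneg B1, abs_nonneg B2]
  · have := hB1 s hs
    rw [Real.norm_eq_abs] at this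
    linarith [le_abs_self B1, abs_nonneg B0, abs_nonneg B2]
  · have := hB2 s hs
    rw [Real.norm_eq_abs] at this
    linarith [le_abs_self B2, abs_nonneg B1, abs_nonneg B0]

/-- The profiles are locally pure exponentials outside the two cutoff zones; this includes the
constants (`c = 0`). -/
theorem derivs_of_eventuallyEq_exp {f : ℝ → ℝ} {s K c : ℝ}
    (h : f =ᶠ[𝓝 s] fun x => K * Real.exp (c * x)) :
    deriv f s = c * f s ∧ deriv (deriv f) s = c ^ 2 * f s := by
  have hd : ∀ K x : ℝ, HasDerivAt (fun x => K * Real.exp (c * x)) (K * c * Real.exp (c * x)) x := by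
    intro K x
    have := (((hasDerivAt_id x).const_mul c).exp).const_mul K
    convert! this using 1
    simp
    ring
  have h1 : deriv f =ᶠ[𝓝 s] fun x => K * c * Real.exp (c * x) := by
    filter_upwards [h.deriv] with x hx
    rw [hx, (hd K x).deriv]
  rw [h1.deriv_eq, (hd _ s).deriv, h1.eq_of_nhds, h.eq_of_nhds]
  constructor <;> ring

open Laplacian in
/-- The Laplacian of a mode whose profile is a slow modulation `f(kt)` of `e^{nt}`. -/
theorem laplacian_cylMode_exp_mul {f : ℝ → ℝ} (hf : ContDiff ℝ 2 f) (n k l : ℝ) (w : ℂ) :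
    laplacian (cylMode (fun t => Real.exp (n * t) * f (k * t)) l) w =
      ((Real.exp (n * w.re) * ((n ^ 2 - l ^ 2) * f (k * w.re) + 2 * n * k * deriv f (k * w.re) +
        k ^ 2 * deriv (deriv f) (k * w.re)) : ℝ) : ℂ) *
        Complex.exp ((l * w.im : ℝ) * Complex.I) := by
  have hf1 : ContDiff ℝ 1 (deriv f) := by
    have : ContDiff ℝ (1 + 1) f := by simpa [one_add_one_eq_two] using hf
    exact (contDiff_succ_iff_deriv.1 this).2.2
  have hlin : ∀ c t : ℝ, HasDerivAt (fun t : ℝ => c * t) c t := fun c t => by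
    simpa using (hasDerivAt_id t).const_mul c
  have hexp : ∀ t : ℝ, HasDerivAt (fun t => Real.exp (n * t)) (Real.exp (n * t) * n) t :=
    fun t => (hlin n t).exp
  have hft : ∀ t : ℝ, HasDerivAt (fun t => f (k * t)) (deriv f (k * t) * k) t := fun t =>
    ((hf.differentiable (by norm_num) (k * t)).hasDerivAt).comp t (hlin k t)
  have hft1 : ∀ t : ℝ, HasDerivAt (fun t => deriv f (k * t)) (deriv (deriv f) (k * t) * k) t :=
    fun t => ((hf1.differentiable (by norm_num) (k * t)).hasDerivAt).comp t (hlin k t)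
  have hC : ContDiff ℝ 2 (fun t => Real.exp (n * t) * f (k * t)) := by fun_prop
  rw [laplacian_cylMode hC (fun t => (hexp t).mul (hft t))
    (((hexp w.re).mul_const n |>.mul (hft w.re)).add ((hexp w.re).mul ((hft1 w.re).mul_const k)))]
  congr 2
  ring

/-- For `0 ≤ α ≤ 1 / 4` the image of the unit circle under `y ↦ y + α y²` meets the positive real
axis only at the image of `y = 1`, and transversally there. -/
theorem norm_one_sub_le_of_pos {r α : ℝ} (hr : 0 < r) (h0 : 0 ≤ α) (h1 : α ≤ 1 / 4) {y : ℂ}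
    (hy : ‖y‖ = 1) : ‖1 - y‖ ≤ 8 * ‖(r : ℂ) - (y + α * y ^ 2)‖ := by
  have hn : y.re ^ 2 + y.im ^ 2 = 1 := by
    have := Complex.normSq_eq_norm_sq y
    rw [hy, Complex.normSq_apply] at this
    linarith
  set c := y.re
  set d := y.im
  have hc1 : -1 ≤ c := by nlinarith
  have hc2 : c ≤ 1 := by nlinarith
  apply le_of_sq_le_sq _ (by positivity)
  rw [mul_pow, ← Complex.normSq_eq_norm_sq, ← Complex.normSq_eq_norm_sq, Complex.normSq_apply,
    Complex.normSq_apply]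
  have e1 : (1 - y).re = 1 - c := by simp [c]
  have e2 : (1 - y).im = -d := by simp [d]
  have e3 : ((r : ℂ) - (y + α * y ^ 2)).re = r - c - α * (c ^ 2 - d ^ 2) := by
    simp [c, d, pow_two]; ring
  have e4 : ((r : ℂ) - (y + α * y ^ 2)).im = -(d * (1 + 2 * α * c)) := by
    simp [c, d, pow_two]; ring
  rw [e1, e2, e3, e4]
  rcases le_or_gt (-(7 / 10)) c with h | h
  · have h65 : 13 / 20 ≤ 1 + 2 * α * c := by nlinarith
    have : (13 / 20) ^ 2 ≤ (1 + 2 * α * c) ^ 2 := pow_le_pow_left₀ (by norm_num) h65 2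
    nlinarith [sq_nonneg (r - c - α * (c ^ 2 - d ^ 2)),
      mul_le_mul_of_nonneg_left this (sq_nonneg d)]
  · have hcd : c ^ 2 - d ^ 2 ≤ 1 := by nlinarith
    have : 9 / 20 ≤ r - c - α * (c ^ 2 - d ^ 2) := by nlinarith
    have := pow_le_pow_left₀ (by norm_num) this 2
    nlinarith [sq_nonneg (d * (1 + 2 * α * c))]

/-! ### The estimate for one transition -/

/-- The radial part of `e^{-nt} Δ (e^{nt} f(kt) e^{ilθ})`, as a function of `s = kt`. -/
noncomputable def conjLap (n k l : ℝ) (f : ℝ → ℝ) (s : ℝ) : ℝ :=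
  (n ^ 2 - l ^ 2) * f s + 2 * n * k * deriv f s + k ^ 2 * deriv (deriv f) s

theorem conjLap_of_eventuallyEq_exp {f : ℝ → ℝ} {s K c : ℝ} (n k l : ℝ)
    (h : f =ᶠ[𝓝 s] fun x => K * Real.exp (c * x)) :
    conjLap n k l f s = ((n + c * k) ^ 2 - l ^ 2) * f s := by
  obtain ⟨h1, h2⟩ := derivs_of_eventuallyEq_exp h
  rw [conjLap, h1, h2]
  ring

/-- Amplitude of the correcting mode in the transition. It is chosen so that the Laplacian of the
sum of the three modes vanishes wherever the sum itself does. -/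
noncomputable def corrCoeff (n k : ℝ) : ℝ := 2 * n * k / ((n - 3 * k) * (2 * n - k))

theorem corrCoeff_nonneg {n k : ℝ} (hk : 0 < k) (hn : 16 * k ≤ n) : 0 ≤ corrCoeff n k := by
  have : 0 < n - 3 * k := by linarith
  have : 0 < 2 * n - k := by linarith
  have : 0 < n := by linarith
  unfold corrCoeff
  positivity

theorem corrCoeff_mul_le {n k : ℝ} (hk : 0 < k) (hn : 16 * k ≤ n) :
    corrCoeff n k * n ≤ 4 * k := by
  have h1 : 0 < n - 3 * k := by linarith
  have h2 : 0 < 2 * n - k := by linarith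
  unfold corrCoeff
  rw [div_mul_eq_mul_div, div_le_iff₀ (by positivity)]
  nlinarith [mul_pos hk hk, mul_nonneg hk.le (sub_nonneg.2 hn),
    mul_nonneg (mul_nonneg hk.le hk.le) (sub_nonneg.2 hn),
    mul_nonneg hk.le (mul_nonneg (sub_nonneg.2 hn) (sub_nonneg.2 hn))]

theorem corrCoeff_le {n k : ℝ} (hk : 0 < k) (hn : 16 * k ≤ n) : corrCoeff n k ≤ 1 / 4 := by
  have h := corrCoeff_mul_le hk hn
  have h0 := corrCoeff_nonneg hk hn
  nlinarith

theorem norm_sub_sub_le {a b c α : ℝ} {y : ℂ} (hy : ‖y‖ = 1) :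
    ‖(a : ℂ) - b * y - α * c * y ^ 2‖ ≤ |a| + |b| + |α * c| := by
  refine (norm_sub_le _ _).trans (add_le_add ((norm_sub_le _ _).trans_eq ?_) (le_of_eq ?_))
  · simp [hy]
  · rw [← Complex.ofReal_mul, norm_mul, norm_pow, hy, Complex.norm_real]
    simp

theorem le_norm_sub_sub {a b c α : ℝ} {y : ℂ} (hy : ‖y‖ = 1) :
    |a| - |b| - |α * c| ≤ ‖(a : ℂ) - b * y - α * c * y ^ 2‖ := by
  have h1 := norm_sub_norm_le ((a : ℂ) - b * y) (α * c * y ^ 2)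
  have h2 := norm_sub_norm_le (a : ℂ) (b * y)
  have e1 : ‖(a : ℂ)‖ = |a| := by simp
  have e2 : ‖(b : ℂ) * y‖ = |b| := by simp [hy]
  have e3 : ‖(α * c * y ^ 2 : ℂ)‖ = |α * c| := by
    rw [← Complex.ofReal_mul, norm_mul, norm_pow, hy, Complex.norm_real]
    simp
  linarith

theorem le_norm_sub_sub' {a b c α : ℝ} {y : ℂ} (hy : ‖y‖ = 1) :
    |b| - |a| - |α * c| ≤ ‖(a : ℂ) - b * y - α * c * y ^ 2‖ := by
  have h1 := norm_sub_norm_le ((a : ℂ) - b * y) (α * c * y ^ 2)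
  have h2 := norm_sub_norm_le ((b : ℂ) * y) a
  rw [norm_sub_rev ((b : ℂ) * y)] at h2
  have e1 : ‖(a : ℂ)‖ = |a| := by simp
  have e2 : ‖(b : ℂ) * y‖ = |b| := by simp [hy]
  have e3 : ‖(α * c * y ^ 2 : ℂ)‖ = |α * c| := by
    rw [← Complex.ofReal_mul, norm_mul, norm_pow, hy, Complex.norm_real]
    simp
  linarith

theorem abs_conjLap_le {n k l B : ℝ} {f : ℝ → ℝ} {s : ℝ} (hk : 0 < k) (hn : 0 < n)
    (h0 : |f s| ≤ B) (h1 : |deriv f s| ≤ B) (h2 : |deriv (deriv f) s| ≤ B) :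
    |conjLap n k l f s| ≤ (|n ^ 2 - l ^ 2| + 2 * n * k + k ^ 2) * B := by
  unfold conjLap
  refine (abs_add_three _ _ _).trans ?_
  rw [abs_mul, abs_mul (2 * n * k), abs_mul (k ^ 2), abs_of_pos (by positivity : 0 < 2 * n * k),
    abs_of_pos (by positivity : 0 < k ^ 2), add_mul, add_mul]
  gcongr

/-- The pointwise estimate behind the transition, after division by `e^{nt - inθ}`; here
`y = e^{i(2n-2k)θ}`. -/
theorem exists_transition_bound : ∃ A : ℝ, 0 < A ∧ ∀ n k : ℝ, 0 < k → 16 * k ≤ n →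
    ∀ (s : ℝ) (y : ℂ), ‖y‖ = 1 →
    ‖(conjLap n k (-n) fadeOut s : ℂ) - conjLap n k (n - 2 * k) midProfile s * y -
        corrCoeff n k * conjLap n k (3 * n - 4 * k) corrProfile s * y ^ 2‖ ≤
      A * (n * k) *
        ‖(fadeOut s : ℂ) - midProfile s * y - corrCoeff n k * corrProfile s * y ^ 2‖ := by
  obtain ⟨B0, hB0, hf0⟩ := exists_bound_derivs contDiff_fadeOut (-2) 2
  obtain ⟨B1, hB1, hf1⟩ := exists_bound_derivs contDiff_midProfile (-2) 2
  obtain ⟨B2, hB2, hf2⟩ := exists_bound_derivs contDiff_corrProfile (-2) 2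
  refine ⟨2 * (3 * B0 + 7 * B1 + 35 * B2) + 64, by positivity, fun n k hk hn s y hy => ?_⟩
  set B := 3 * B0 + 7 * B1 + 35 * B2 with hB
  have hBnn : 0 ≤ B := by positivity
  have hnpos : 0 < n := by linarith
  have hkn : k ≤ n := by linarith
  have hα0 := corrCoeff_nonneg hk hn
  have hα1 := corrCoeff_le hk hn
  have hαn := corrCoeff_mul_le hk hn
  have hkk : k ^ 2 ≤ n * k := by nlinarith
  have hnk : 0 < n * k := by positivity
  -- off the region where the first two modes are comparable, crude bounds suffice
  have crude : s ∈ Set.Icc (-2 : ℝ) 2 →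
      1 / 2 ≤ ‖(fadeOut s : ℂ) - midProfile s * y - corrCoeff n k * corrProfile s * y ^ 2‖ →
      ‖(conjLap n k (-n) fadeOut s : ℂ) - conjLap n k (n - 2 * k) midProfile s * y -
        corrCoeff n k * conjLap n k (3 * n - 4 * k) corrProfile s * y ^ 2‖ ≤
      (2 * B + 64) * (n * k) *
        ‖(fadeOut s : ℂ) - midProfile s * y - corrCoeff n k * corrProfile s * y ^ 2‖ := by
    intro hs hlow
    have b0 := abs_conjLap_le (l := -n) hk hnpos (hf0 s hs).1 (hf0 s hs).2.1 (hf0 s hs).2.2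
    have b1 := abs_conjLap_le (l := n - 2 * k) hk hnpos (hf1 s hs).1 (hf1 s hs).2.1 (hf1 s hs).2.2
    have b2 := abs_conjLap_le (l := 3 * n - 4 * k) hk hnpos (hf2 s hs).1 (hf2 s hs).2.1
      (hf2 s hs).2.2
    have c0 : |n ^ 2 - (-n) ^ 2| + 2 * n * k + k ^ 2 ≤ 3 * (n * k) := by
      rw [neg_sq, sub_self, abs_zero]
      linarith
    have c1 : |n ^ 2 - (n - 2 * k) ^ 2| + 2 * n * k + k ^ 2 ≤ 7 * (n * k) := by
      rw [abs_of_nonneg (by nlinarith)]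
      nlinarith
    have c2 : corrCoeff n k * (|n ^ 2 - (3 * n - 4 * k) ^ 2| + 2 * n * k + k ^ 2) ≤
        35 * (n * k) := by
      have h8 : |n ^ 2 - (3 * n - 4 * k) ^ 2| ≤ 8 * n ^ 2 := by
        rw [abs_le]
        constructor <;> nlinarith
      have h9 : corrCoeff n k * |n ^ 2 - (3 * n - 4 * k) ^ 2| ≤ 8 * n * (4 * k) := by
        calc _ ≤ corrCoeff n k * (8 * n ^ 2) := by gcongr
          _ = 8 * n * (corrCoeff n k * n) := by ring
          _ ≤ _ := by gcongr
      nlinarith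
    have d0 := b0.trans (mul_le_mul_of_nonneg_right c0 hB0)
    have d1 := b1.trans (mul_le_mul_of_nonneg_right c1 hB1)
    have d2 : |corrCoeff n k * conjLap n k (3 * n - 4 * k) corrProfile s| ≤ 35 * (n * k) * B2 := by
      rw [abs_mul, abs_of_nonneg hα0]
      calc _ ≤ corrCoeff n k *
            ((|n ^ 2 - (3 * n - 4 * k) ^ 2| + 2 * n * k + k ^ 2) * B2) := by gcongr
        _ = corrCoeff n k * (|n ^ 2 - (3 * n - 4 * k) ^ 2| + 2 * n * k + k ^ 2) * B2 := by ring
        _ ≤ _ := by gcongr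
    calc _ ≤ 3 * (n * k) * B0 + 7 * (n * k) * B1 + 35 * (n * k) * B2 :=
          (norm_sub_sub_le hy).trans (by gcongr)
      _ = 2 * B * (n * k) * (1 / 2) := by rw [hB]; ring
      _ ≤ (2 * B + 64) * (n * k) * (1 / 2) := by gcongr; linarith
      _ ≤ _ := by gcongr
  rcases lt_or_ge s (-2) with h | h
  · have e0 : fadeOut =ᶠ[𝓝 s] fun x => 1 * Real.exp (0 * x) := by
      filter_upwards [Iio_mem_nhds h] with x hx
      simp [fadeOut_of_le (by linarith [Set.mem_Iio.1 hx] : x ≤ 1)]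
    have e1 : midProfile =ᶠ[𝓝 s] fun x => 0 * Real.exp (0 * x) := by
      filter_upwards [Iio_mem_nhds h] with x hx
      simp [midProfile, fadeIn_of_le (Set.mem_Iio.1 hx).le]
    have e2 : corrProfile =ᶠ[𝓝 s] fun x => 0 * Real.exp (0 * x) := by
      filter_upwards [Iio_mem_nhds h] with x hx
      simp [corrProfile, fadeIn_of_le (Set.mem_Iio.1 hx).le]
    rw [conjLap_of_eventuallyEq_exp _ _ _ e0, conjLap_of_eventuallyEq_exp _ _ _ e1,
      conjLap_of_eventuallyEq_exp _ _ _ e2, e1.eq_of_nhds, e2.eq_of_nhds]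
    simp
    positivity
  rcases lt_or_ge 2 s with h' | h'
  · have e0 : fadeOut =ᶠ[𝓝 s] fun x => 0 * Real.exp (0 * x) := by
      filter_upwards [Ioi_mem_nhds h'] with x hx
      simp [fadeOut_of_ge (Set.mem_Ioi.1 hx).le]
    have e1 : midProfile =ᶠ[𝓝 s] fun x => Real.exp 6 * Real.exp (-2 * x) := by
      filter_upwards [Ioi_mem_nhds h'] with x hx
      have hx := Set.mem_Ioi.1 hx
      rw [midProfile, fadeIn_of_ge (by linarith), bend_of_ge hx.le, one_mul, ← Real.exp_add]
      ring_nf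
    have e2 : corrProfile =ᶠ[𝓝 s] fun x => 0 * Real.exp (0 * x) := by
      filter_upwards [Ioi_mem_nhds h'] with x hx
      simp [corrProfile, fadeOut_of_ge (Set.mem_Ioi.1 hx).le]
    rw [conjLap_of_eventuallyEq_exp _ _ _ e0, conjLap_of_eventuallyEq_exp _ _ _ e1,
      conjLap_of_eventuallyEq_exp _ _ _ e2, e0.eq_of_nhds, e2.eq_of_nhds]
    have : (n + -2 * k) ^ 2 - (n - 2 * k) ^ 2 = 0 := by ring
    rw [this]
    simp
    positivity
  rcases le_or_gt s (-1) with hs1 | hs1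
  · apply crude ⟨h, h'⟩
    have e0 : fadeOut s = 1 := fadeOut_of_le (by linarith)
    have hexp : Real.exp (2 * s) ≤ 1 / 3 := by
      have h3 : (3 : ℝ) ≤ Real.exp (-(2 * s)) := by linarith [Real.add_one_le_exp (-(2 * s))]
      have h4 : Real.exp (2 * s) * Real.exp (-(2 * s)) = 1 := by rw [← Real.exp_add]; simp
      nlinarith [Real.exp_pos (2 * s)]
    have hm0 : 0 ≤ midProfile s := by
      rw [midProfile, bend_of_le (by linarith)]
      exact mul_nonneg (fadeIn_nonneg s) (Real.exp_pos _).le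
    have hm1 : midProfile s ≤ 1 / 3 := by
      rw [midProfile, bend_of_le (by linarith)]
      nlinarith [fadeIn_le_one s, fadeIn_nonneg s, Real.exp_pos (2 * s)]
    have hc : corrProfile s = midProfile s := by rw [corrProfile, e0, one_mul, midProfile]
    refine le_trans ?_ (le_norm_sub_sub hy)
    rw [e0, hc, abs_mul, abs_of_nonneg hm0, abs_of_nonneg hα0, abs_one]
    nlinarith
  rcases lt_or_ge s 1 with hs2 | hs2
  · -- here the sum of the modes has zeros, and the two sides are explicit
    have e0 : fadeOut =ᶠ[𝓝 s] fun x => 1 * Real.exp (0 * x) := by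
      filter_upwards [Iio_mem_nhds hs2] with x hx
      simp [fadeOut_of_le (Set.mem_Iio.1 hx).le]
    have e1 : midProfile =ᶠ[𝓝 s] fun x => 1 * Real.exp (2 * x) := by
      filter_upwards [Ioo_mem_nhds hs1 hs2] with x hx
      rw [midProfile, fadeIn_of_ge hx.1.le, bend_of_le hx.2.le]
    have e2 : corrProfile =ᶠ[𝓝 s] fun x => 1 * Real.exp (2 * x) := by
      filter_upwards [Ioo_mem_nhds hs1 hs2] with x hx
      rw [corrProfile, fadeIn_of_ge hx.1.le, bend_of_le hx.2.le, fadeOut_of_le hx.2.le, one_mul]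
    rw [conjLap_of_eventuallyEq_exp _ _ _ e0, conjLap_of_eventuallyEq_exp _ _ _ e1,
      conjLap_of_eventuallyEq_exp _ _ _ e2, e0.eq_of_nhds, e1.eq_of_nhds, e2.eq_of_nhds]
    have hα : corrCoeff n k * ((n + 2 * k) ^ 2 - (3 * n - 4 * k) ^ 2) = -(8 * (n * k)) := by
      have h1 : n - 3 * k ≠ 0 := by linarith
      have h2 : 2 * n - k ≠ 0 := by linarith
      rw [corrCoeff, div_mul_eq_mul_div, div_eq_iff (mul_ne_zero h1 h2)]
      ring
    set E := Real.exp (2 * s)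
    have hE : 0 < E := Real.exp_pos _
    have lhs : (((((n + 0 * k) ^ 2 - (-n) ^ 2) * (1 * Real.exp (0 * s)) : ℝ) : ℂ) -
        (((n + 2 * k) ^ 2 - (n - 2 * k) ^ 2) * (1 * E) : ℝ) * y -
        corrCoeff n k * (((n + 2 * k) ^ 2 - (3 * n - 4 * k) ^ 2) * (1 * E) : ℝ) * y ^ 2) =
        ((-(8 * (n * k) * E) : ℝ) : ℂ) * (y * (1 - y)) := by
      have hα' : (corrCoeff n k : ℂ) * (((n + 2 * k) ^ 2 - (3 * n - 4 * k) ^ 2 : ℝ) : ℂ) =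
          ((-(8 * (n * k)) : ℝ) : ℂ) := by exact_mod_cast hα
      push_cast at hα' ⊢
      linear_combination (-(E : ℂ) * y ^ 2) * hα'
    have rhs : ((1 * Real.exp (0 * s) : ℝ) : ℂ) - (1 * E : ℝ) * y -
        corrCoeff n k * (1 * E : ℝ) * y ^ 2 =
        (E : ℂ) * (((E⁻¹ : ℝ) : ℂ) - (y + corrCoeff n k * y ^ 2)) := by
      have : (E : ℂ) ≠ 0 := by exact_mod_cast hE.ne'
      push_cast
      field_simp
      simp
      ring
    rw [lhs, rhs, norm_mul, norm_mul, norm_mul, hy, one_mul, Complex.norm_real, Complex.norm_real,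
      Real.norm_eq_abs, Real.norm_eq_abs, abs_neg, abs_of_pos hE,
      abs_of_pos (by positivity : 0 < 8 * (n * k) * E)]
    have key := norm_one_sub_le_of_pos (inv_pos.2 hE) hα0 hα1 hy
    set R := ‖((E⁻¹ : ℝ) : ℂ) - (y + corrCoeff n k * y ^ 2)‖
    calc 8 * (n * k) * E * ‖1 - y‖ ≤ 8 * (n * k) * E * (8 * R) := by gcongr
      _ = 64 * (n * k) * (E * R) := by ring
      _ ≤ (2 * B + 64) * (n * k) * (E * R) := by gcongr; linarith
  · apply crude ⟨h, h'⟩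
    have hb := three_le_bend hs2 h'
    have hm : midProfile s = bend s := by rw [midProfile, fadeIn_of_ge (by linarith), one_mul]
    have hc : corrProfile s = fadeOut s * bend s := by
      rw [corrProfile, fadeIn_of_ge (by linarith), one_mul]
    have hc1 : fadeOut s * bend s ≤ bend s := by nlinarith [fadeOut_le_one s]
    have hc0 : 0 ≤ fadeOut s * bend s := mul_nonneg (fadeOut_nonneg s) (by linarith)
    refine le_trans ?_ (le_norm_sub_sub' hy)
    rw [hm, hc, abs_mul, abs_of_nonneg (by linarith : 0 ≤ bend s), abs_of_nonneg hα0,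
      abs_of_nonneg (fadeOut_nonneg s), abs_of_nonneg hc0]
    have := mul_le_mul hα1 hc1 hc0 (by norm_num)
    linarith [fadeOut_le_one s]

/-! ### Functions on the cylinder -/

theorem cylMode_periodic (a : ℝ → ℝ) (l : ℤ) (w : ℂ) :
    cylMode a l (w + 2 * Real.pi * Complex.I) = cylMode a l w := by
  have e1 : (w + 2 * Real.pi * Complex.I).re = w.re := by simp
  have e2 : (w + 2 * Real.pi * Complex.I).im = w.im + 2 * Real.pi := by simp
  rw [cylMode, cylMode, e1, e2]
  congr 1
  rw [Complex.exp_eq_exp_iff_exists_int]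
  exact ⟨l, by push_cast; ring⟩

open Laplacian ComplexConjugate in
/-- A single transition: `e^{nt - inθ}` is turned into a multiple of `e^{(n-2k)(t + iθ)}`. -/
theorem exists_transition : ∃ A : ℝ, 0 < A ∧ ∀ n k : ℕ, 0 < k → 16 * k ≤ n →
    ∃ S : ℂ → ℂ, ContDiff ℝ 2 S ∧ (∀ w, S (w + 2 * Real.pi * Complex.I) = S w) ∧
      (∀ w, ‖laplacian S w‖ ≤ A * (n * k) * ‖S w‖) ∧
      (∀ w : ℂ, k * w.re ≤ -2 → S w = Complex.exp (n * conj w)) ∧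
      ∀ w : ℂ, 2 ≤ k * w.re → S w = -Real.exp 6 * Complex.exp ((n - 2 * k : ℝ) * w) := by
  obtain ⟨A, hA, hbound⟩ := exists_transition_bound
  refine ⟨A, hA, fun n k hk hn => ?_⟩
  have hkR : (0 : ℝ) < k := by exact_mod_cast hk
  have hnR : (16 : ℝ) * k ≤ n := by exact_mod_cast hn
  set prof : (ℝ → ℝ) → ℝ → ℝ := fun f t => Real.exp (n * t) * f (k * t) with hprof
  have hprofC : ∀ {f : ℝ → ℝ}, ContDiff ℝ 2 f → ContDiff ℝ 2 (prof f) := by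
    intro f hf
    simp only [hprof]
    fun_prop
  set α := corrCoeff n k
  set M0 := cylMode (prof fadeOut) (-n) with hM0
  set M1 := cylMode (prof midProfile) (n - 2 * k) with hM1
  set M2 := cylMode (prof corrProfile) (3 * n - 4 * k) with hM2
  have hC0 : ContDiff ℝ 2 M0 := contDiff_cylMode (hprofC contDiff_fadeOut) _
  have hC1 : ContDiff ℝ 2 M1 := contDiff_cylMode (hprofC contDiff_midProfile) _
  have hC2 : ContDiff ℝ 2 M2 := contDiff_cylMode (hprofC contDiff_corrProfile) _
  set S : ℂ → ℂ := fun w => M0 w - M1 w - α * M2 w with hS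
  have hCα : ContDiff ℝ 2 (fun w => (α : ℂ) * M2 w) := contDiff_const.mul hC2
  -- all three modes share the factor `e^{nt - inθ}`, and the quotients are powers of one phase
  have phase : ∀ (w : ℂ) (x0 x1 x2 : ℝ),
      ((Real.exp (n * w.re) * x0 : ℝ) : ℂ) * Complex.exp ((-n * w.im : ℝ) * Complex.I) -
      ((Real.exp (n * w.re) * x1 : ℝ) : ℂ) * Complex.exp (((n - 2 * k) * w.im : ℝ) * Complex.I) -
      α * (((Real.exp (n * w.re) * x2 : ℝ) : ℂ) *
        Complex.exp (((3 * n - 4 * k) * w.im : ℝ) * Complex.I)) =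
      (Real.exp (n * w.re) : ℂ) * Complex.exp ((-n * w.im : ℝ) * Complex.I) *
        (x0 - x1 * Complex.exp (((2 * n - 2 * k) * w.im : ℝ) * Complex.I) -
          α * x2 * Complex.exp (((2 * n - 2 * k) * w.im : ℝ) * Complex.I) ^ 2) := by
    intro w x0 x1 x2
    have p1 : Complex.exp (((n - 2 * k) * w.im : ℝ) * Complex.I) =
        Complex.exp ((-n * w.im : ℝ) * Complex.I) *
          Complex.exp (((2 * n - 2 * k) * w.im : ℝ) * Complex.I) := by
      rw [← Complex.exp_add]
      push_cast
      ring_nf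
    have p2 : Complex.exp (((3 * n - 4 * k) * w.im : ℝ) * Complex.I) =
        Complex.exp ((-n * w.im : ℝ) * Complex.I) *
          Complex.exp (((2 * n - 2 * k) * w.im : ℝ) * Complex.I) ^ 2 := by
      rw [← Complex.exp_nat_mul, ← Complex.exp_add]
      push_cast
      ring_nf
    rw [p1, p2]
    push_cast
    ring
  have hSw : ∀ w, S w = (Real.exp (n * w.re) : ℂ) * Complex.exp ((-n * w.im : ℝ) * Complex.I) *
        (fadeOut (k * w.re) -
          midProfile (k * w.re) * Complex.exp (((2 * n - 2 * k) * w.im : ℝ) * Complex.I) -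
          α * corrProfile (k * w.re) *
            Complex.exp (((2 * n - 2 * k) * w.im : ℝ) * Complex.I) ^ 2) := fun w =>
    phase w _ _ _
  refine ⟨S, (hC0.sub hC1).sub hCα, fun w => ?_, fun w => ?_, fun w hw => ?_, fun w hw => ?_⟩
  · have p0 := cylMode_periodic (prof fadeOut) (-n) w
    have p1 := cylMode_periodic (prof midProfile) (n - 2 * k) w
    have p2 := cylMode_periodic (prof corrProfile) (3 * n - 4 * k) w
    push_cast at p0 p1 p2
    simp only [hS, hM0, hM1, hM2, p0, p1, p2]
  · have hL : laplacian S w = laplacian M0 w - laplacian M1 w - α * laplacian M2 w := by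
      have h1 := (hC0.sub hC1).contDiffAt.laplacian_sub (hCα.contDiffAt (x := w))
      have h2 := hC0.contDiffAt.laplacian_sub (hC1.contDiffAt (x := w))
      have h3 := laplacian_const_mul (α : ℂ) (hC2.contDiffAt (x := w))
      rw [← h3, ← h2]
      exact h1
    rw [hL, hM0, hM1, hM2, laplacian_cylMode_exp_mul contDiff_fadeOut,
      laplacian_cylMode_exp_mul contDiff_midProfile,
      laplacian_cylMode_exp_mul contDiff_corrProfile, phase, hSw, norm_mul, norm_mul _ (_ - _)]
    have hb := hbound n k hkR hnR (k * w.re)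
      (Complex.exp (((2 * n - 2 * k) * w.im : ℝ) * Complex.I)) (Complex.norm_exp_ofReal_mul_I _)
    calc _ ≤ _ := mul_le_mul_of_nonneg_left hb (norm_nonneg _)
      _ = _ := by ring
  · rw [hSw, midProfile, corrProfile, fadeOut_of_le (by linarith), fadeIn_of_le hw]
    simp only [zero_mul, mul_zero, Complex.ofReal_zero, sub_zero, Complex.ofReal_one, mul_one]
    rw [Complex.ofReal_exp, ← Complex.exp_add]
    congr 1
    apply Complex.ext <;> simp
  · rw [hSw, midProfile, corrProfile, fadeOut_of_ge hw, fadeIn_of_ge (by linarith), bend_of_ge hw]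
    simp only [zero_mul, mul_zero, Complex.ofReal_zero, sub_zero, zero_sub, one_mul]
    rw [Complex.ofReal_exp, Complex.ofReal_exp, Complex.ofReal_exp, mul_neg, neg_mul,
      ← Complex.exp_add, ← Complex.exp_add, ← Complex.exp_add, neg_mul, ← Complex.exp_add]
    congr 2
    apply Complex.ext
    · simp; ring
    · simp; ring

open Laplacian ComplexConjugate in
/-- There is a `C²` function `U` on the cylinder with coordinate `w = t + iθ` which satisfies
`|ΔU| ≤ A |U|`, equals `e^{nt - inθ}` for `t ≤ 0`, and equals a multiple of a bounded harmonic
mode `e^{-|j|t + ijθ}` for `t ≥ T`. -/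
def HasBridge (A T : ℝ) (n : ℕ) : Prop :=
  ∃ U : ℂ → ℂ, ContDiff ℝ 2 U ∧ (∀ w, U (w + 2 * Real.pi * Complex.I) = U w) ∧
    (∀ w, ‖laplacian U w‖ ≤ A * ‖U w‖) ∧
    (∀ w : ℂ, w.re ≤ 0 → U w = Complex.exp (n * conj w)) ∧
    ∃ (c : ℂ) (j : ℤ), ∀ w : ℂ, T ≤ w.re →
      U w = c * Complex.exp ((-|(j : ℝ)| * w.re : ℝ) + (j * w.im : ℝ) * Complex.I)

theorem HasBridge.mono {A T T' : ℝ} {n : ℕ} (h : HasBridge A T n) (hT : T ≤ T') :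
    HasBridge A T' n := by
  obtain ⟨U, h1, h2, h3, h4, c, j, h5⟩ := h
  exact ⟨U, h1, h2, h3, h4, c, j, fun w hw => h5 w (hT.trans hw)⟩

open Laplacian in
/-- Two functions which agree on the strip `L₁ ≤ Re w ≤ L₂` are glued along its right edge; the
overlap makes the result locally equal to one of them. -/
theorem glue_strip {S V : ℂ → ℂ} {A L₁ L₂ : ℝ} (hL : L₁ < L₂) (hS : ContDiff ℝ 2 S)
    (hV : ContDiff ℝ 2 V) (hSb : ∀ w, ‖laplacian S w‖ ≤ A * ‖S w‖)
    (hVb : ∀ w, ‖laplacian V w‖ ≤ A * ‖V w‖)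
    (hSV : ∀ w : ℂ, L₁ ≤ w.re → w.re ≤ L₂ → S w = V w) :
    ∃ U : ℂ → ℂ, U = (fun w => if w.re ≤ L₂ then S w else V w) ∧ ContDiff ℝ 2 U ∧
      ∀ w, ‖laplacian U w‖ ≤ A * ‖U w‖ := by
  set U : ℂ → ℂ := fun w => if w.re ≤ L₂ then S w else V w with hU
  have loc : ∀ w, U =ᶠ[𝓝 w] S ∨ U =ᶠ[𝓝 w] V := by
    intro w
    rcases lt_or_ge w.re L₂ with h | h
    · left
      filter_upwards [Complex.continuous_re.continuousAt.eventually (Iio_mem_nhds h)] with z hz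
      exact if_pos (le_of_lt hz)
    · right
      filter_upwards [Complex.continuous_re.continuousAt.eventually
        (Ioi_mem_nhds (hL.trans_le h))] with z hz
      by_cases h' : z.re ≤ L₂
      · rw [hU]
        simp only [h', if_true]
        exact hSV z (le_of_lt hz) h'
      · exact if_neg h'
  refine ⟨U, rfl, contDiff_iff_contDiffAt.2 fun w => ?_, fun w => ?_⟩
  · rcases loc w with h | h
    · exact hS.contDiffAt.congr_of_eventuallyEq h
    · exact hV.contDiffAt.congr_of_eventuallyEq h
  · rcases loc w with h | h
    · rw [(InnerProductSpace.laplacian_congr_nhds h).eq_of_nhds, h.eq_of_nhds]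
      exact hSb w
    · rw [(InnerProductSpace.laplacian_congr_nhds h).eq_of_nhds, h.eq_of_nhds]
      exact hVb w

open Laplacian ComplexConjugate in
/-- A transition from `n` to `m = n - 2k`, followed by the complex conjugate of a bridge starting
with `m`. -/
theorem HasBridge.transition {A T L₁ L₂ : ℝ} {n m : ℕ} (h : HasBridge A T m) (hL0 : 0 ≤ L₁)
    (hT : 0 < T)
    (hL : L₁ < L₂) {S : ℂ → ℂ} {c₀ : ℂ} (hS : ContDiff ℝ 2 S)
    (hper : ∀ w, S (w + 2 * Real.pi * Complex.I) = S w)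
    (hb : ∀ w, ‖laplacian S w‖ ≤ A * ‖S w‖)
    (hstart : ∀ w : ℂ, w.re ≤ 0 → S w = Complex.exp (n * conj w))
    (hend : ∀ w : ℂ, L₁ ≤ w.re → S w = c₀ * Complex.exp (m * w)) :
    HasBridge A (T + L₂) n := by
  obtain ⟨V, hV, hVper, hVb, hVstart, c, j, hVend⟩ := h
  set c₁ : ℂ := c₀ * Complex.exp (m * L₂)
  have hVs : ContDiff ℝ 2 (fun w : ℂ => V (w - L₂)) := hV.comp (contDiff_id.sub contDiff_const)
  have hVc : ContDiff ℝ 2 (fun w : ℂ => conj (V (w - L₂))) :=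
    Complex.conjCLE.contDiff.comp hVs
  have hW : ContDiff ℝ 2 (fun w : ℂ => c₁ * conj (V (w - L₂))) := contDiff_const.mul hVc
  have hWb : ∀ w, ‖laplacian (fun w : ℂ => c₁ * conj (V (w - L₂))) w‖ ≤
      A * ‖c₁ * conj (V (w - L₂))‖ := by
    intro w
    rw [laplacian_const_mul _ hVc.contDiffAt, laplacian_conj_comp hVs.contDiffAt,
      laplacian_comp_sub_const _ hV.contDiffAt, norm_mul c₁, norm_mul c₁, Complex.norm_conj,
      Complex.norm_conj]
    calc _ ≤ ‖c₁‖ * (A * ‖V (w - L₂)‖) := by gcongr; exact hVb _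
      _ = _ := by ring
  obtain ⟨U, hU, hUC, hUb⟩ := glue_strip hL hS hW hb hWb (fun w h1 h2 => by
    rw [hend w h1, hVstart _ (by simpa using h2), ← Complex.exp_conj, mul_assoc, ← Complex.exp_add]
    congr 2
    simp
    ring)
  refine ⟨U, hUC, fun w => ?_, hUb, fun w hw => ?_, ?_⟩
  · have e1 : (w + 2 * Real.pi * Complex.I).re = w.re := by simp
    have e2 : w + 2 * Real.pi * Complex.I - L₂ = w - L₂ + 2 * Real.pi * Complex.I := by ring
    simp only [hU, e1, e2, hper, hVper]
  · simp only [hU, if_pos (hw.trans (hL0.trans hL.le)), hstart w hw]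
  · refine ⟨c₁ * conj c * Complex.exp ((|(j : ℝ)| * L₂ : ℝ)), -j, fun w hw => ?_⟩
    have hw' : ¬ w.re ≤ L₂ := by linarith
    simp only [hU, if_neg hw']
    have he : Complex.exp (conj (((-|(j : ℝ)| * (w - L₂).re : ℝ) : ℂ) +
        ((j * (w - L₂).im : ℝ) : ℂ) * Complex.I)) = Complex.exp ((|(j : ℝ)| * L₂ : ℝ)) *
        Complex.exp ((-|((-j : ℤ) : ℝ)| * w.re : ℝ) + (((-j : ℤ) : ℝ) * w.im : ℝ) * Complex.I) := by
      rw [← Complex.exp_add]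
      congr 1
      apply Complex.ext
      · simp
        ring
      · simp
    have hre : T ≤ (w - L₂).re := by
      rw [Complex.sub_re, Complex.ofReal_re]
      linarith
    rw [hVend (w - L₂) hre, map_mul, ← Complex.exp_conj, he]
    ring

open Laplacian ComplexConjugate in
/-- For `n = O(k)` a radial cutoff passes from `e^{nt}` to `e^{-nt}` at once, with the angular
factor unchanged. -/
theorem exists_bridge_base : ∃ A : ℝ, 0 < A ∧ ∀ n k : ℕ, 0 < k → n ≤ 16 * k →
    HasBridge (A * k ^ 2) (1 / k) n := by
  set f : ℝ → ℝ := fun s => fadeOut (s + 1) with hf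
  set g : ℝ → ℝ := fun s => 1 - fadeOut (s + 1) with hg
  have hfC : ContDiff ℝ 2 f := contDiff_fadeOut.comp (contDiff_id.add contDiff_const)
  have hgC : ContDiff ℝ 2 g := contDiff_const.sub hfC
  obtain ⟨B, hB, hfB⟩ := exists_bound_derivs hfC 0 1
  obtain ⟨B', hB', hgB⟩ := exists_bound_derivs hgC 0 1
  refine ⟨Real.exp 32 * (33 * (B + B')) + 1, by positivity, fun n k hk hn => ?_⟩
  have hkR : (0 : ℝ) < k := by exact_mod_cast hk
  have hnR : (n : ℝ) ≤ 16 * k := by exact_mod_cast hn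
  have hn0 : (0 : ℝ) ≤ n := n.cast_nonneg
  set F : ℝ → ℝ := fun t => Real.exp (n * t) * f (k * t) with hF
  set G : ℝ → ℝ := fun t => Real.exp (-n * t) * g (k * t) with hG
  have hFC : ContDiff ℝ 2 F := by fun_prop
  have hGC : ContDiff ℝ 2 G := by fun_prop
  have hCF := contDiff_cylMode hFC (-n)
  have hCG := contDiff_cylMode hGC (-n)
  have hUw : ∀ w, (cylMode F (-n) + cylMode G (-n)) w =
      ((F w.re + G w.re : ℝ) : ℂ) * Complex.exp ((-n * w.im : ℝ) * Complex.I) := by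
    intro w
    simp only [Pi.add_apply, cylMode]
    push_cast
    ring
  refine ⟨cylMode F (-n) + cylMode G (-n), hCF.add hCG, fun w => ?_, fun w => ?_, fun w hw => ?_,
    1, -n, fun w hw => ?_⟩
  · have p0 := cylMode_periodic F (-n) w
    have p1 := cylMode_periodic G (-n) w
    push_cast at p0 p1
    simp only [Pi.add_apply, p0, p1]
  · have hL : laplacian (cylMode F (-n) + cylMode G (-n)) w =
        ((Real.exp (n * w.re) * conjLap n k (-n) f (k * w.re) +
          Real.exp (-n * w.re) * conjLap (-n) k (-n) g (k * w.re) : ℝ) : ℂ) *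
          Complex.exp ((-n * w.im : ℝ) * Complex.I) := by
      rw [hCF.contDiffAt.laplacian_add hCG.contDiffAt, laplacian_cylMode_exp_mul hfC,
        laplacian_cylMode_exp_mul hgC, conjLap, conjLap]
      push_cast
      ring
    rw [hL, hUw, norm_mul, norm_mul, Complex.norm_exp_ofReal_mul_I, mul_one, mul_one,
      Complex.norm_real, Complex.norm_real, Real.norm_eq_abs, Real.norm_eq_abs]
    set s : ℝ := k * w.re with hs
    rcases lt_or_ge s 0 with h | h
    · have e0 : f =ᶠ[𝓝 s] fun x => 1 * Real.exp (0 * x) := by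
        filter_upwards [Iio_mem_nhds h] with x hx
        simp [hf, fadeOut_of_le (by linarith [Set.mem_Iio.1 hx] : x + 1 ≤ 1)]
      have e1 : g =ᶠ[𝓝 s] fun x => 0 * Real.exp (0 * x) := by
        filter_upwards [Iio_mem_nhds h] with x hx
        simp [hg, fadeOut_of_le (by linarith [Set.mem_Iio.1 hx] : x + 1 ≤ 1)]
      rw [conjLap_of_eventuallyEq_exp _ _ _ e0, conjLap_of_eventuallyEq_exp _ _ _ e1,
        e1.eq_of_nhds]
      simp
      positivity
    rcases lt_or_ge 1 s with h' | h'
    · have e0 : f =ᶠ[𝓝 s] fun x => 0 * Real.exp (0 * x) := by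
        filter_upwards [Ioi_mem_nhds h'] with x hx
        simp [hf, fadeOut_of_ge (by linarith [Set.mem_Ioi.1 hx] : 2 ≤ x + 1)]
      have e1 : g =ᶠ[𝓝 s] fun x => 1 * Real.exp (0 * x) := by
        filter_upwards [Ioi_mem_nhds h'] with x hx
        simp [hg, fadeOut_of_ge (by linarith [Set.mem_Ioi.1 hx] : 2 ≤ x + 1)]
      rw [conjLap_of_eventuallyEq_exp _ _ _ e0, conjLap_of_eventuallyEq_exp _ _ _ e1,
        e0.eq_of_nhds]
      simp
      positivity
    have hx0 : 0 ≤ n * w.re := by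
      have : 0 ≤ w.re := by
        by_contra hneg
        push Not at hneg
        nlinarith
      positivity
    have hx1 : n * w.re ≤ 16 := by
      have : 0 ≤ w.re := by
        by_contra hneg
        push Not at hneg
        nlinarith
      nlinarith
    have ef : Real.exp (n * w.re) ≤ Real.exp 16 := Real.exp_le_exp.2 hx1
    have eg : Real.exp (-n * w.re) ≤ Real.exp 16 := Real.exp_le_exp.2 (by linarith)
    have hlap : ∀ {h : ℝ → ℝ} {B : ℝ} {σ : ℝ}, |σ| = n →
        |deriv h s| ≤ B → |deriv (deriv h) s| ≤ B → 0 ≤ B →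
        |conjLap σ k (-n) h s| ≤ 33 * k ^ 2 * B := by
      intro h B σ hσ h1 h2 h0
      have : σ ^ 2 - (-(n : ℝ)) ^ 2 = 0 := by rw [← sq_abs σ, hσ]; ring
      rw [conjLap, this, zero_mul, zero_add]
      refine (abs_add_le _ _).trans ?_
      rw [abs_mul, abs_mul (k ^ 2 : ℝ), abs_mul, abs_mul, hσ, abs_of_pos hkR, abs_two,
        abs_of_pos (by positivity : (0 : ℝ) < k ^ 2)]
      calc _ ≤ 2 * (16 * k) * k * B + k ^ 2 * B := by gcongr
        _ = _ := by ring
    have hs01 : s ∈ Set.Icc (0 : ℝ) 1 := ⟨h, h'⟩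
    have l1 := hlap (h := f) (σ := n) (abs_of_nonneg hn0) (hfB s hs01).2.1 (hfB s hs01).2.2 hB
    have l2 := hlap (h := g) (σ := -n) (by rw [abs_neg, abs_of_nonneg hn0])
      (hgB s hs01).2.1 (hgB s hs01).2.2 hB'
    have low : Real.exp (-16) ≤ F w.re + G w.re := by
      have a1 : Real.exp (-16) ≤ Real.exp (n * w.re) := Real.exp_le_exp.2 (by linarith)
      have a2 : Real.exp (-16) ≤ Real.exp (-n * w.re) := Real.exp_le_exp.2 (by linarith)
      simp only [hF, hG, hf, hg]
      nlinarith [fadeOut_nonneg (k * w.re + 1), fadeOut_le_one (k * w.re + 1)]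
    calc _ ≤ Real.exp 16 * (33 * k ^ 2 * B) + Real.exp 16 * (33 * k ^ 2 * B') := by
          refine (abs_add_le _ _).trans ?_
          rw [abs_mul, abs_mul, abs_of_pos (Real.exp_pos _), abs_of_pos (Real.exp_pos _)]
          gcongr
      _ = Real.exp 32 * (33 * (B + B')) * k ^ 2 * Real.exp (-16) := by
          have : Real.exp 16 = Real.exp 32 * Real.exp (-16) := by
            rw [← Real.exp_add]; norm_num
          rw [this]; ring
      _ ≤ (Real.exp 32 * (33 * (B + B')) + 1) * k ^ 2 * Real.exp (-16) := by
          gcongr; linarith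
      _ ≤ _ := by
          gcongr
          exact low.trans (le_abs_self _)
  · have e0 : f (k * w.re) = 1 := fadeOut_of_le (by nlinarith)
    have e1 : g (k * w.re) = 0 := by
      simp only [hg]
      rw [fadeOut_of_le (by nlinarith), sub_self]
    rw [hUw]
    simp only [hF, hG, e0, e1, mul_one, mul_zero, add_zero]
    rw [Complex.ofReal_exp, ← Complex.exp_add]
    congr 1
    apply Complex.ext <;> simp
  · have hks : 1 ≤ k * w.re := by
      rw [div_le_iff₀ hkR] at hw
      linarith
    have e0 : f (k * w.re) = 0 := fadeOut_of_ge (by linarith)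
    have e1 : g (k * w.re) = 1 := by
      simp only [hg]
      rw [fadeOut_of_ge (by linarith), sub_zero]
    rw [hUw]
    simp only [hF, hG, e0, e1, mul_one, mul_zero, zero_add]
    rw [Complex.ofReal_exp, ← Complex.exp_add, one_mul]
    congr 1
    apply Complex.ext <;> simp

open Laplacian ComplexConjugate in
/-- Bridges of bounded length, with `A` of order `k³`, for all `n ≤ k²`. -/
theorem exists_bridge : ∃ A : ℝ, 0 < A ∧ ∀ n k : ℕ, 0 < k → n ≤ k ^ 2 →
    HasBridge (A * k ^ 3) 10 n := by
  obtain ⟨A₁, hA₁, hstep⟩ := exists_transition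
  obtain ⟨A₂, hA₂, hbase⟩ := exists_bridge_base
  refine ⟨A₁ + A₂, by positivity, fun n k hk hn => ?_⟩
  have hkR : (1 : ℝ) ≤ k := by exact_mod_cast hk
  have hk0 : (0 : ℝ) < k := by linarith
  -- each transition costs `5 / k` of length and lowers `n` by `2k`
  have main : ∀ n : ℕ, n ≤ k ^ 2 → HasBridge ((A₁ + A₂) * k ^ 3) (5 * (n + k) / k ^ 2) n := by
    intro n
    induction n using Nat.strong_induction_on with
    | _ n ih =>
      intro hn
      have hnR : (n : ℝ) ≤ k ^ 2 := by exact_mod_cast hn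
      rcases le_or_gt n (16 * k) with h | h
      · obtain ⟨U, h1, h2, h3, h4⟩ := (hbase n k hk h).mono (T' := 5 * (n + k) / k ^ 2) (by
          rw [div_le_div_iff₀ hk0 (by positivity)]
          have : (0 : ℝ) ≤ n := n.cast_nonneg
          nlinarith [mul_nonneg this hk0.le])
        refine ⟨U, h1, h2, fun w => (h3 w).trans ?_, h4⟩
        gcongr
        · linarith
        · norm_num
      · obtain ⟨m, rfl⟩ : ∃ m, n = m + 2 * k := ⟨n - 2 * k, by omega⟩
        have hm := ih m (by omega) (by omega)
        obtain ⟨S, hS, hper, hb, hst, hen⟩ := hstep (m + 2 * k) k hk h.le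
        set d : ℝ := 2 / k with hd
        have hkd : k * d = 2 := by rw [hd]; field_simp
        set e : ℂ := Complex.exp ((m + 2 * k : ℕ) * (d : ℂ))
        have hSs : ContDiff ℝ 2 (fun w : ℂ => S (w - d)) :=
          hS.comp (contDiff_id.sub contDiff_const)
        have hb' := hm.transition (n := m + 2 * k) (L₁ := 4 / k) (L₂ := 5 / k)
          (S := fun w => e * S (w - d))
          (c₀ := e * (-Real.exp 6) * Complex.exp (-(m * d))) (by positivity) (by positivity)
          (by gcongr; norm_num)
          (contDiff_const.mul hSs)
          (fun w => by
            have : w + 2 * Real.pi * Complex.I - d = w - d + 2 * Real.pi * Complex.I := by ring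
            simp only [this, hper])
          (fun w => by
            rw [laplacian_const_mul _ hSs.contDiffAt, laplacian_comp_sub_const _ hS.contDiffAt,
              norm_mul, norm_mul]
            calc ‖e‖ * _ ≤ ‖e‖ * (A₁ * ((m + 2 * k : ℕ) * k) * ‖S (w - d)‖) := by
                  gcongr; exact hb _
              _ ≤ ‖e‖ * ((A₁ + A₂) * (k ^ 2 * k) * ‖S (w - d)‖) := by
                  gcongr; linarith
              _ = _ := by ring)
          (fun w hw => by
            rw [hst _ (by
              have : (w - d).re = w.re - d := by simp
              rw [this]; nlinarith), ← Complex.exp_add]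
            congr 1
            simp
            ring)
          (fun w hw => by
            rw [hen _ (by
              have : (w - d).re = w.re - d := by simp
              rw [div_le_iff₀ hk0] at hw
              rw [this]; nlinarith), mul_assoc e, mul_assoc e, mul_assoc (-(Real.exp 6 : ℂ)),
              ← Complex.exp_add]
            congr 3
            push_cast
            ring)
        refine hb'.mono ?_
        rw [div_add_div _ _ (by positivity) hk0.ne',
          div_le_div_iff₀ (by positivity) (by positivity)]
        push_cast
        have : (0 : ℝ) < k ^ 4 := by positivity
        nlinarith
  refine (main n hn).mono ?_
  have hnR : (n : ℝ) ≤ k ^ 2 := by exact_mod_cast hn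
  rw [div_le_iff₀ (by positivity)]
  nlinarith

/-! ### Stereographic coordinates on the sphere -/

open scoped RealInnerProductSpace

/-- The stereographic coordinate, extended homogeneously of degree zero. For `σ = 1` it is centred
at `b 2` (and has its pole at `-b 2`), for `σ = -1` the other way round. -/
noncomputable def stereo (b : OrthonormalBasis (Fin 3) ℝ E3) (σ : ℝ) (y : E3) : ℂ :=
  ((⟪b 0, y⟫ : ℂ) + ⟪b 1, y⟫ * Complex.I) / ((‖y‖ + σ * ⟪b 2, y⟫ : ℝ) : ℂ)

theorem stereo_smul (b : OrthonormalBasis (Fin 3) ℝ E3) (σ : ℝ) {c : ℝ} (hc : 0 < c) (y : E3) :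
    stereo b σ (c • y) = stereo b σ y := by
  have hc' : (c : ℂ) ≠ 0 := by exact_mod_cast hc.ne'
  have e1 : ((⟪b 0, c • y⟫ : ℝ) : ℂ) + (⟪b 1, c • y⟫ : ℝ) * Complex.I =
      c * ((⟪b 0, y⟫ : ℂ) + ⟪b 1, y⟫ * Complex.I) := by
    rw [inner_smul_right, inner_smul_right]
    push_cast
    ring
  have e2 : ((‖c • y‖ + σ * ⟪b 2, c • y⟫ : ℝ) : ℂ) = c * ((‖y‖ + σ * ⟪b 2, y⟫ : ℝ) : ℂ) := by
    rw [norm_smul, Real.norm_of_nonneg hc.le, inner_smul_right]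
    push_cast
    ring
  rw [stereo, e1, e2, mul_div_mul_left _ _ hc', stereo]

theorem contDiffAt_stereo (b : OrthonormalBasis (Fin 3) ℝ E3) (σ : ℝ) {x : E3} (hx : x ≠ 0)
    (hq : ‖x‖ + σ * ⟪b 2, x⟫ ≠ 0) : ContDiffAt ℝ 2 (stereo b σ) x := by
  have hof : ContDiff ℝ 2 (fun x : ℝ => (x : ℂ)) := Complex.ofRealCLM.contDiff
  have hin : ∀ i, ContDiff ℝ 2 (fun y : E3 => ⟪b i, y⟫) := fun i =>
    contDiff_const.inner ℝ contDiff_id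
  have hnorm : ContDiffAt ℝ 2 (fun y : E3 => ‖y‖) x := contDiffAt_norm ℝ hx
  have hden : ContDiffAt ℝ 2 (fun y : E3 => ((‖y‖ + σ * ⟪b 2, y⟫ : ℝ) : ℂ)) x :=
    hof.contDiffAt.comp x (hnorm.add (contDiffAt_const.mul (hin 2).contDiffAt))
  have hnum : ContDiffAt ℝ 2 (fun y : E3 => (⟪b 0, y⟫ : ℂ) + ⟪b 1, y⟫ * Complex.I) x :=
    (((hof.comp (hin 0))).add ((hof.comp (hin 1)).mul contDiff_const)).contDiffAt
  have := hnum.mul (hden.inv (by exact_mod_cast hq))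
  simpa only [stereo, div_eq_mul_inv] using! this

theorem sum_sq_inner_basis (b : OrthonormalBasis (Fin 3) ℝ E3) (x : E3) :
    ⟪b 0, x⟫ ^ 2 + ⟪b 1, x⟫ ^ 2 + ⟪b 2, x⟫ ^ 2 = ‖x‖ ^ 2 := by
  have := b.sum_sq_inner_right x
  rwa [Fin.sum_univ_three] at this

/-- First and second derivatives of the stereographic coordinate along an orthonormal frame. -/
theorem stereo_derivs (b : OrthonormalBasis (Fin 3) ℝ E3) (σ : ℝ) {x : E3} (hx : ‖x‖ = 1)
    (hq : 1 + σ * ⟪b 2, x⟫ ≠ 0) (i : Fin 3) :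
    fderiv ℝ (stereo b σ) x (b i) =
      ((⟪b 0, b i⟫ : ℂ) + ⟪b 1, b i⟫ * Complex.I) / ((1 + σ * ⟪b 2, x⟫ : ℝ) : ℂ) -
      ((⟪b 0, x⟫ : ℂ) + ⟪b 1, x⟫ * Complex.I) * ((⟪b i, x⟫ + σ * ⟪b 2, b i⟫ : ℝ) : ℂ) /
        ((1 + σ * ⟪b 2, x⟫ : ℝ) : ℂ) ^ 2 ∧
    fderiv ℝ (fderiv ℝ (stereo b σ)) x (b i) (b i) =
      -(2 * ((⟪b 0, b i⟫ : ℂ) + ⟪b 1, b i⟫ * Complex.I) * ((⟪b i, x⟫ + σ * ⟪b 2, b i⟫ : ℝ) : ℂ)) /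
        ((1 + σ * ⟪b 2, x⟫ : ℝ) : ℂ) ^ 2 -
      ((⟪b 0, x⟫ : ℂ) + ⟪b 1, x⟫ * Complex.I) * ((1 - ⟪b i, x⟫ ^ 2 : ℝ) : ℂ) /
        ((1 + σ * ⟪b 2, x⟫ : ℝ) : ℂ) ^ 2 +
      2 * ((⟪b 0, x⟫ : ℂ) + ⟪b 1, x⟫ * Complex.I) * ((⟪b i, x⟫ + σ * ⟪b 2, b i⟫ : ℝ) : ℂ) ^ 2 /
        ((1 + σ * ⟪b 2, x⟫ : ℝ) : ℂ) ^ 3 := by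
  have hx0 : x ≠ 0 := by
    rintro rfl
    simp at hx
  have hC : ContDiffAt ℝ 2 (stereo b σ) x := contDiffAt_stereo b σ hx0 (by rwa [hx])
  set ξ := ⟪b i, x⟫ with hξ
  set a₀ : ℂ := (⟪b 0, x⟫ : ℂ) + ⟪b 1, x⟫ * Complex.I with ha₀
  set v : ℂ := (⟪b 0, b i⟫ : ℂ) + ⟪b 1, b i⟫ * Complex.I with hv
  set δ := ⟪b 2, b i⟫ with hδ
  set η := ⟪b 2, x⟫ with hη
  set r : ℝ → ℝ := fun s => 1 + 2 * ξ * s + s ^ 2 with hr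
  set p : ℝ → ℝ := fun s => √(r s) + σ * (η + s * δ) with hp
  set p' : ℝ → ℝ := fun s => (ξ + s) / √(r s) + σ * δ with hp'
  have hline : ∀ s : ℝ, stereo b σ (x + s • b i) = (a₀ + s * v) / (p s : ℂ) := by
    intro s
    have hn : ‖x + s • b i‖ = √(r s) := by
      have hb : ‖b i‖ = 1 := b.norm_eq_one i
      have hsq : ‖x + s • b i‖ ^ 2 = r s := by
        rw [norm_add_sq_real, norm_smul, hb, hx, inner_smul_right, real_inner_comm, mul_one,
          Real.norm_eq_abs, sq_abs]
        simp only [hr, hξ]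
        ring
      rw [← hsq, Real.sqrt_sq (norm_nonneg _)]
    rw [stereo, hn]
    simp only [inner_add_right, inner_smul_right]
    congr 1
    rw [ha₀, hv]
    push_cast
    ring
  have hr0 : r 0 = 1 := by simp [hr]
  have hp0 : p 0 = 1 + σ * η := by simp [hp, hr0]
  have hp'0 : p' 0 = ξ + σ * δ := by simp [hp', hr0]
  have hrd : ∀ s, HasDerivAt r (2 * ξ + 2 * s) s := by
    intro s
    have := (((hasDerivAt_id s).const_mul (2 * ξ)).const_add 1).add (hasDerivAt_pow 2 s)
    convert! this using 1
    simp
  have hpd : ∀ s, r s ≠ 0 → HasDerivAt p (p' s) s := by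
    intro s hs
    have h1 := (hrd s).sqrt hs
    have h2 : HasDerivAt (fun s : ℝ => σ * (η + s * δ)) (σ * δ) s := by
      simpa using (((hasDerivAt_id s).mul_const δ).const_add η).const_mul σ
    convert! h1.add h2 using 1
    simp only [hp']
    rw [← mul_add, mul_div_mul_left _ _ two_ne_zero]
  have hp'd : HasDerivAt p' (1 - ξ ^ 2) 0 := by
    have h1 := (hrd 0).sqrt (by rw [hr0]; exact one_ne_zero)
    have h2 := (((hasDerivAt_id (0 : ℝ)).const_add ξ).div h1 (by simp [hr0])).add_const (σ * δ)
    convert! h2 using 1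
    simp [hr0]
    ring
  have had : ∀ s : ℝ, HasDerivAt (fun s : ℝ => a₀ + s * v) v s := by
    intro s
    simpa using ((hasDerivAt_id s).ofReal_comp.mul_const v).const_add a₀
  have hrc : ContinuousAt r 0 := (hrd 0).continuousAt
  have hpc : ContinuousAt p 0 := (hpd 0 (by rw [hr0]; exact one_ne_zero)).continuousAt
  have hev : ∀ᶠ s in 𝓝 (0 : ℝ), r s ≠ 0 ∧ p s ≠ 0 :=
    (hrc.eventually_ne (by rw [hr0]; exact one_ne_zero)).and
      (hpc.eventually_ne (by rw [hp0]; exact hq))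
  have hqC : ((1 + σ * η : ℝ) : ℂ) ≠ 0 := by exact_mod_cast hq
  have h1 : ∀ s, r s ≠ 0 ∧ p s ≠ 0 → HasDerivAt (fun s : ℝ => stereo b σ (x + s • b i))
      (v / (p s : ℂ) - (a₀ + s * v) * (p' s : ℂ) / (p s : ℂ) ^ 2) s := by
    rintro s ⟨hs1, hs2⟩
    have hs2' : (p s : ℂ) ≠ 0 := by exact_mod_cast hs2
    have := (had s).div (hpd s hs1).ofReal_comp hs2'
    simp_rw [hline]
    convert! this using 1
    field_simp
  constructor
  · rw [fderiv_eq_of_line (hC.differentiableAt (by norm_num)) (h1 0 hev.self_of_nhds), hp0, hp'0]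
    simp
  · refine fderiv_fderiv_eq_of_line hC (hev.mono h1) ?_
    have hpd0 := (hpd 0 hev.self_of_nhds.1).ofReal_comp
    have hp0' : (p 0 : ℂ) ≠ 0 := by exact_mod_cast hev.self_of_nhds.2
    have h2 := ((hasDerivAt_const (0 : ℝ) v).div hpd0 hp0').sub
      (((had 0).mul hp'd.ofReal_comp).div (hpd0.pow 2) (pow_ne_zero 2 hp0'))
    convert! h2 using 1
    simp only [Pi.mul_apply, Pi.pow_apply, hp0, hp'0]
    field_simp
    push_cast
    ring

/-- A homogeneous map of degree zero which agrees with `u` on the sphere near `x` agrees with the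
homogeneous extension of `u` on a neighbourhood of `x` in space. -/
theorem homogExt_eventuallyEq {u : S2 → ℂ} {F : E3 → ℂ} {x : S2}
    (hF : ∀ (c : ℝ) (y : E3), 0 < c → F (c • y) = F y) (h : ∀ᶠ z : S2 in 𝓝 x, u z = F z) :
    homogExt u =ᶠ[𝓝 (x : E3)] F := by
  have hx0 : (x : E3) ≠ 0 := ne_zero_of_mem_unit_sphere x
  have hx1 : ‖(x : E3)‖ = 1 := norm_eq_of_mem_sphere x
  obtain ⟨t, ht, hsub⟩ := mem_nhds_subtype _ _ _ |>.1 h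
  have hcont : Filter.Tendsto (fun y : E3 => ‖y‖⁻¹ • y) (𝓝 (x : E3)) (𝓝 (x : E3)) := by
    have h1 : ContinuousAt (fun y : E3 => ‖y‖⁻¹ • y) (x : E3) :=
      (continuous_norm.continuousAt.inv₀ (by rw [hx1]; exact one_ne_zero)).smul continuousAt_id
    have h2 := h1.tendsto
    simpa [hx1] using h2
  filter_upwards [hcont ht, isOpen_ne.mem_nhds hx0] with y hy hy0
  have hpos : 0 < ‖y‖⁻¹ := inv_pos.2 (norm_pos_iff.2 hy0)
  rw [homogExt, dif_neg hy0, ← hF _ y hpos]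
  exact hsub (a := ⟨‖y‖⁻¹ • y, _⟩) hy

open Laplacian in
/-- In a stereographic coordinate the Laplacian of the sphere is a multiple of the flat one. -/
theorem sphere_local_form (b : OrthonormalBasis (Fin 3) ℝ E3) {σ : ℝ} (hσ : σ ^ 2 = 1) {u : S2 → ℂ}
    {V : ℂ → ℂ} {x : S2} (hq : 1 + σ * ⟪b 2, (x : E3)⟫ ≠ 0)
    (hV : ContDiffAt ℝ 2 V (stereo b σ x)) (h : ∀ᶠ z : S2 in 𝓝 x, u z = V (stereo b σ z)) :
    ContDiffAt ℝ 2 (homogExt u) x ∧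
      sphereLaplacian u x =
        (((1 + σ * ⟪b 2, (x : E3)⟫) ^ 2)⁻¹ : ℝ) * laplacian V (stereo b σ x) := by
  have hx1 : ‖(x : E3)‖ = 1 := norm_eq_of_mem_sphere x
  have hx0 : (x : E3) ≠ 0 := ne_zero_of_mem_unit_sphere x
  have hloc : homogExt u =ᶠ[𝓝 (x : E3)] V ∘ stereo b σ :=
    homogExt_eventuallyEq (fun c y hc => by simp [stereo_smul b σ hc]) h
  have hC := contDiffAt_stereo b σ hx0 (by rwa [hx1])
  refine ⟨(hV.comp _ hC).congr_of_eventuallyEq hloc, ?_⟩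
  rw [sphereLaplacian, (InnerProductSpace.laplacian_congr_nhds hloc).eq_of_nhds]
  have hs := sum_sq_inner_basis b x
  rw [hx1, one_pow] at hs
  have o : ∀ i j, ⟪b i, b j⟫ = if i = j then (1 : ℝ) else 0 := fun i j =>
    orthonormal_iff_ite.1 b.orthonormal i j
  have d0 := stereo_derivs b σ hx1 hq 0
  have d1 := stereo_derivs b σ hx1 hq 1
  have d2 := stereo_derivs b σ hx1 hq 2
  simp only [o, Fin.isValue, Fin.reduceEq, if_true, if_false] at d0 d1 d2
  set X := ⟪b 0, (x : E3)⟫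
  set Y := ⟪b 1, (x : E3)⟫
  set H := ⟪b 2, (x : E3)⟫
  set q := 1 + σ * H with hqdef
  have hqC : (q : ℂ) ≠ 0 := by exact_mod_cast hq
  have re_im : ∀ (A B C : ℝ), (((A : ℂ) + B * Complex.I) / (q : ℂ) - ((X : ℂ) + Y * Complex.I) *
      (C : ℂ) / (q : ℂ) ^ 2) = ((A / q - X * C / q ^ 2 : ℝ) : ℂ) +
      ((B / q - Y * C / q ^ 2 : ℝ) : ℂ) * Complex.I := by
    intro A B C
    push_cast
    ring
  obtain ⟨d0, c0⟩ := d0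
  obtain ⟨d1, c1⟩ := d1
  obtain ⟨d2, c2⟩ := d2
  rw [re_im] at d0 d1 d2
  have hP : X ^ 2 + Y ^ 2 + (H + σ) ^ 2 = 2 * q := by
    rw [hqdef]
    linear_combination hs + hσ
  have cre : ∀ A B : ℝ, ((A : ℂ) + B * Complex.I).re = A := fun A B => by simp
  have cim : ∀ A B : ℝ, ((A : ℂ) + B * Complex.I).im = B := fun A B => by simp
  refine laplacian_comp_of_conformal b hC hV ?_ ?_ ?_ ?_
  · rw [Fin.sum_univ_three, c0, c1, c2]
    have hsC : (X : ℂ) ^ 2 + Y ^ 2 + H ^ 2 = 1 := by exact_mod_cast hs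
    have hPC : (X : ℂ) ^ 2 + Y ^ 2 + (H + σ) ^ 2 = 2 * q := by exact_mod_cast hP
    push_cast
    field_simp
    linear_combination (q * (X + Y * Complex.I)) * hsC + 2 * (X + Y * Complex.I) * hPC
  · rw [Fin.sum_univ_three, d0, d1, d2, cre, cre, cre]
    field_simp
    linear_combination X ^ 2 * hP
  · rw [Fin.sum_univ_three, d0, d1, d2, cim, cim, cim]
    field_simp
    linear_combination Y ^ 2 * hP
  · rw [Fin.sum_univ_three, d0, d1, d2, cre, cre, cre, cim, cim, cim]
    field_simp
    linear_combination X * Y * hP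

theorem norm_sq_stereo (b : OrthonormalBasis (Fin 3) ℝ E3) {σ : ℝ} (hσ : σ ^ 2 = 1) (x : S2)
    (hq : 1 + σ * ⟪b 2, (x : E3)⟫ ≠ 0) :
    ‖stereo b σ x‖ ^ 2 * (1 + σ * ⟪b 2, (x : E3)⟫) = 1 - σ * ⟪b 2, (x : E3)⟫ := by
  have hs := sum_sq_inner_basis b x
  rw [norm_eq_of_mem_sphere x, one_pow] at hs
  rw [stereo, norm_eq_of_mem_sphere x, norm_div, div_pow, ← Complex.normSq_eq_norm_sq,
    Complex.normSq_add_mul_I, Complex.norm_real, Real.norm_eq_abs, sq_abs]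
  field_simp
  linear_combination hs + ⟪b 2, (x : E3)⟫ ^ 2 * hσ

open ComplexConjugate in
theorem stereo_neg_mul_conj (b : OrthonormalBasis (Fin 3) ℝ E3) (x : S2)
    (hq : 1 + ⟪b 2, (x : E3)⟫ ≠ 0) (hq' : 1 - ⟪b 2, (x : E3)⟫ ≠ 0) :
    stereo b (-1) x * conj (stereo b 1 x) = 1 := by
  have hs := sum_sq_inner_basis b x
  rw [norm_eq_of_mem_sphere x, one_pow] at hs
  have hqC : (1 : ℂ) + (⟪b 2, (x : E3)⟫ : ℝ) ≠ 0 := by exact_mod_cast hq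
  have hqC' : (1 : ℂ) - (⟪b 2, (x : E3)⟫ : ℝ) ≠ 0 := by exact_mod_cast hq'
  have hsC : ((⟪b 0, (x : E3)⟫ : ℝ) : ℂ) ^ 2 + ((⟪b 1, (x : E3)⟫ : ℝ) : ℂ) ^ 2 +
      ((⟪b 2, (x : E3)⟫ : ℝ) : ℂ) ^ 2 = 1 := by exact_mod_cast hs
  have e1 : (((1 : ℝ) + -1 * ⟪b 2, (x : E3)⟫ : ℝ) : ℂ) = 1 - (⟪b 2, (x : E3)⟫ : ℝ) := by
    push_cast; ring
  have e2 : (((1 : ℝ) + 1 * ⟪b 2, (x : E3)⟫ : ℝ) : ℂ) = 1 + (⟪b 2, (x : E3)⟫ : ℝ) := by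
    push_cast; ring
  rw [stereo, stereo, norm_eq_of_mem_sphere x, e1, e2]
  simp only [map_div₀, map_add, map_mul, Complex.conj_ofReal, Complex.conj_I, map_one]
  rw [div_mul_div_comm, div_eq_one_iff_eq (mul_ne_zero hqC' hqC)]
  linear_combination hsC - ((⟪b 1, (x : E3)⟫ : ℝ) : ℂ) ^ 2 * Complex.I_sq

theorem dist_sq_sphere (P x : S2) : dist x P ^ 2 = 2 * (1 - ⟪(P : E3), (x : E3)⟫) := by
  rw [Subtype.dist_eq, dist_eq_norm, norm_sub_sq_real, norm_eq_of_mem_sphere x,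
    norm_eq_of_mem_sphere P, real_inner_comm]
  ring

theorem eq_of_inner_eq_one {P x : S2} (h : 1 - ⟪(P : E3), (x : E3)⟫ = 0) : x = P := by
  have := dist_sq_sphere P x
  rw [h, mul_zero] at this
  exact dist_eq_zero.1 (pow_eq_zero_iff two_ne_zero |>.1 this)

theorem eq_neg_of_inner_eq_neg_one {P x : S2} (h : 1 + ⟪(P : E3), (x : E3)⟫ = 0) : x = -P := by
  apply eq_of_inner_eq_one
  have : (((-P : S2)) : E3) = -(P : E3) := rfl
  rw [this, inner_neg_left]
  linarith

instance sphere_nhdsNE_neBot (P : S2) : Filter.NeBot (𝓝[≠] P) := by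
  have hr : 1 < Module.rank ℝ E3 := by
    rw [← Module.finrank_eq_rank, finrank_euclideanSpace_fin]
    norm_num
  have : ConnectedSpace S2 :=
    Subtype.connectedSpace (isConnected_sphere hr (0 : E3) zero_le_one)
  have : Nontrivial S2 := ⟨P, -P, fun h => by
    have h1 : (P : E3) = -(P : E3) := congrArg Subtype.val h
    have h2 : (2 : ℝ) • (P : E3) = 0 := by
      rw [two_smul]
      nth_rewrite 2 [h1]
      exact add_neg_cancel _
    exact (smul_ne_zero two_ne_zero (ne_zero_of_mem_unit_sphere P)) h2⟩
  infer_instance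

/-- Near its centre the modulus of the stereographic coordinate is comparable to the distance. -/
theorem vanishesWithOrder_of_norm_eq (b : OrthonormalBasis (Fin 3) ℝ E3) {P : S2}
    (hb : b 2 = P) {u : S2 → ℂ} {N : ℕ}
    (h : ∀ᶠ x : S2 in 𝓝 P, ‖u x‖ = ‖stereo b 1 x‖ ^ N) : VanishesWithOrder u P N := by
  have hPP : ⟪(P : E3), (P : E3)⟫ = 1 := by
    rw [real_inner_self_eq_norm_sq, norm_eq_of_mem_sphere P, one_pow]
  have hpos : ∀ᶠ x : S2 in 𝓝 P, 0 < ⟪(P : E3), (x : E3)⟫ := by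
    have hc : Continuous fun x : S2 => ⟪(P : E3), (x : E3)⟫ :=
      continuous_const.inner continuous_subtype_val
    have h0 : (0 : ℝ) < ⟪(P : E3), (P : E3)⟫ := by
      rw [hPP]
      exact one_pos
    exact hc.continuousAt.eventually (lt_mem_nhds h0)
  have hcomp : ∀ᶠ x : S2 in 𝓝 P, ‖stereo b 1 x‖ ≤ dist x P ∧ dist x P ≤ 2 * ‖stereo b 1 x‖ := by
    filter_upwards [hpos] with x hx
    have h1 := dist_sq_sphere P x
    have h2 := norm_sq_stereo b (σ := 1) (by norm_num) x (by rw [hb, one_mul]; linarith)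
    have h3 : ⟪(P : E3), (x : E3)⟫ ≤ 1 := by
      have := real_inner_le_norm (P : E3) (x : E3)
      rwa [norm_eq_of_mem_sphere, norm_eq_of_mem_sphere, one_mul] at this
    rw [hb, one_mul] at h2
    constructor
    · apply le_of_sq_le_sq _ dist_nonneg
      nlinarith [sq_nonneg ‖stereo b 1 x‖]
    · apply le_of_sq_le_sq _ (by positivity)
      nlinarith [sq_nonneg ‖stereo b 1 x‖]
  constructor
  · refine IsBigO.of_bound 1 ?_
    filter_upwards [h, hcomp] with x hx hc
    rw [hx, one_mul, norm_pow, Real.norm_of_nonneg dist_nonneg]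
    exact pow_le_pow_left₀ (norm_nonneg _) hc.1 N
  · intro ho
    have hO : (fun x : S2 => dist x P ^ N) =O[𝓝 P] u := by
      refine IsBigO.of_bound (2 ^ N) ?_
      filter_upwards [h, hcomp] with x hx hc
      rw [hx, norm_pow, Real.norm_of_nonneg dist_nonneg, ← mul_pow]
      exact pow_le_pow_left₀ dist_nonneg hc.2 N
    refine isLittleO_irrefl' ?_ (hO.trans_isLittleO ho)
    have hne : ∃ᶠ x : S2 in 𝓝[≠] P, x ∈ ({P}ᶜ : Set S2) :=
      Filter.Eventually.frequently eventually_mem_nhdsWithin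
    refine (hne.filter_mono nhdsWithin_le_nhds).mono fun x hx => ?_
    rw [norm_ne_zero_iff]
    exact pow_ne_zero N (dist_ne_zero.2 hx)

open Laplacian in
theorem ContDiffAt.continuousAt_laplacian {E : Type*} [NormedAddCommGroup E]
    [InnerProductSpace ℝ E] [FiniteDimensional ℝ E] {f : E → ℂ} {x : E}
    (hf : ContDiffAt ℝ 2 f x) : ContinuousAt (laplacian f) x := by
  have h1 : ContDiffAt ℝ 1 (fderiv ℝ f) x := hf.fderiv_right (by norm_num)
  have h2 : ContinuousAt (fderiv ℝ (fderiv ℝ f)) x :=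
    (h1.fderiv_right (m := 0) (by norm_num)).continuousAt
  have h3 : laplacian f = fun y => ∑ i, fderiv ℝ (fderiv ℝ f) y
      (stdOrthonormalBasis ℝ E i) (stdOrthonormalBasis ℝ E i) :=
    funext fun y => laplacian_eq_sum_fderiv _ f y
  rw [h3]
  exact tendsto_finsetSum _ fun i _ =>
    (h2.clm_apply continuousAt_const).clm_apply continuousAt_const

theorem contMDiff_of_homogExt {u : S2 → ℂ} (h : ∀ x : S2, ContDiffAt ℝ 2 (homogExt u) x) :
    ContMDiff (𝓡 2) 𝓘(ℝ, ℂ) 2 u := by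
  have hu : u = homogExt u ∘ ((↑) : S2 → E3) := by
    funext x
    have hx : (x : E3) ≠ 0 := ne_zero_of_mem_unit_sphere x
    rw [Function.comp_apply, homogExt, dif_neg hx]
    congr 1
    apply Subtype.ext
    simp [norm_eq_of_mem_sphere x]
  have : Fact (Module.finrank ℝ E3 = 2 + 1) := ⟨by simp⟩
  intro x
  rw [hu]
  exact (h x).contMDiffAt.comp x (contMDiff_coe_sphere x)

theorem continuous_sphereLaplacian {u : S2 → ℂ}
    (h : ∀ x : S2, ContDiffAt ℝ 2 (homogExt u) x) : Continuous (sphereLaplacian u) :=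
  continuous_iff_continuousAt.2 fun x =>
    (h x).continuousAt_laplacian.comp continuous_subtype_val.continuousAt

/-- Local branches of the logarithm are invisible to a `2πi`-periodic function. -/
theorem exists_local_log {U : ℂ → ℂ} (hper : ∀ w, U (w + 2 * Real.pi * Complex.I) = U w) {z₀ : ℂ}
    (hz : z₀ ≠ 0) : ∃ ℓ : ℂ → ℂ, AnalyticAt ℂ ℓ z₀ ∧ ℓ z₀ = Complex.log z₀ ∧
      deriv ℓ z₀ = z₀⁻¹ ∧ ∀ᶠ z in 𝓝 z₀, U (Complex.log z) = U (ℓ z) := by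
  have hslit : z₀ / z₀ ∈ Complex.slitPlane := by
    rw [div_self hz]
    exact Complex.one_mem_slitPlane
  have hdiv : HasDerivAt (fun z : ℂ => z / z₀) (1 / z₀) z₀ := (hasDerivAt_id z₀).div_const z₀
  have hana : AnalyticAt ℂ (fun z : ℂ => z / z₀) z₀ := by fun_prop
  refine ⟨fun z => Complex.log (z / z₀) + Complex.log z₀,
    (hana.clog hslit).add analyticAt_const, by simp [div_self hz], ?_, ?_⟩
  · have := (hdiv.clog hslit).add_const (Complex.log z₀)
    rw [this.deriv, div_self hz, div_one, one_div]
  · filter_upwards [isOpen_ne.mem_nhds hz] with z hz'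
    have hexp : Complex.exp (Complex.log z) =
        Complex.exp (Complex.log (z / z₀) + Complex.log z₀) := by
      rw [Complex.exp_add, Complex.exp_log hz', Complex.exp_log (div_ne_zero hz' hz),
        Complex.exp_log hz, div_mul_cancel₀ _ hz]
    obtain ⟨n, hn⟩ := Complex.exp_eq_exp_iff_exists_int.1 hexp
    rw [hn]
    exact (Function.Periodic.int_mul (f := U) hper n) _

/-! ### From the cylinder to the sphere -/

theorem exists_orthonormalBasis_third (P : S2) :
    ∃ b : OrthonormalBasis (Fin 3) ℝ E3, b 2 = P := by
  have hv : Orthonormal ℝ (({2} : Set (Fin 3)).domRestrict fun _ => (P : E3)) := by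
    refine ⟨fun _ => norm_eq_of_mem_sphere P, fun i j hij => absurd (Subsingleton.elim i j) hij⟩
  obtain ⟨b, hb⟩ := hv.exists_orthonormalBasis_extension_of_card_eq (by simp)
  exact ⟨b, hb 2 rfl⟩

open Laplacian ComplexConjugate in
/-- A bounded mode on a half-infinite cylinder extends harmonically over the added point. -/
theorem exists_harmonic_cap (c : ℂ) (j : ℤ) : ∃ g : ℂ → ℂ, ContDiff ℝ 2 g ∧
    (∀ z, laplacian g z = 0) ∧ ∀ w : ℂ, g (Complex.exp (-conj w)) =
      c * Complex.exp ((-|(j : ℝ)| * w.re : ℝ) + (j * w.im : ℝ) * Complex.I) := by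
  have hpow : ∀ m : ℕ, ContDiff ℝ 2 fun z : ℂ => z ^ m := fun m => contDiff_id.pow m
  have hlap : ∀ (m : ℕ) (z : ℂ), laplacian (fun z : ℂ => z ^ m) z = 0 := fun m z =>
    laplacian_eq_zero_of_analyticAt (by fun_prop)
  rcases le_or_gt 0 j with hj | hj
  · obtain ⟨m, rfl⟩ := Int.eq_ofNat_of_zero_le hj
    refine ⟨fun z => c * z ^ m, contDiff_const.mul (hpow m), fun z => ?_, fun w => ?_⟩
    · rw [laplacian_const_mul c (hpow m).contDiffAt, hlap, mul_zero]
    · simp only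
      rw [← Complex.exp_nat_mul]
      congr 2
      apply Complex.ext <;> simp
  · obtain ⟨m, hm⟩ := Int.eq_ofNat_of_zero_le (neg_nonneg.2 hj.le)
    obtain rfl : j = -(m : ℤ) := by omega
    have hC : ContDiff ℝ 2 fun z : ℂ => conj (z ^ m) := Complex.conjCLE.contDiff.comp (hpow m)
    refine ⟨fun z => c * conj (z ^ m), contDiff_const.mul hC, fun z => ?_, fun w => ?_⟩
    · rw [laplacian_const_mul c hC.contDiffAt, laplacian_conj_comp (hpow m).contDiffAt, hlap,
        map_zero, mul_zero]
    · simp only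
      rw [← Complex.exp_nat_mul, ← Complex.exp_conj]
      congr 2
      apply Complex.ext <;> simp

open Laplacian ComplexConjugate in
/-- Transplanting a bridge to the sphere. The last factor bounds the conformal factor
`(1 + |z|²)² / (4|z|²)` on the band `1 ≤ |z| ≤ e^T`, outside of which `u` is harmonic. -/
theorem exists_solution_of_hasBridge {A T : ℝ} {N : ℕ} (hA : 0 ≤ A) (hN : 1 ≤ N)
    (h : HasBridge A T N) (P : S2) :
    ∃ W u : S2 → ℂ, MemLp W ⊤ surfaceMeasure ∧
      (eLpNorm W ⊤ surfaceMeasure).toReal ≤ (1 + Real.exp T ^ 2) ^ 2 / 4 * A ∧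
      ContMDiff (𝓡 2) 𝓘(ℝ, ℂ) 2 u ∧ (∀ x : S2, sphereLaplacian u x + W x * u x = 0) ∧
      VanishesWithOrder u P N ∧ HasCompactSupport W ∧ tsupport W ⊆ ({P, -P} : Set S2)ᶜ := by
  obtain ⟨U, hU, hper, hbound, hstart, c, j, hend⟩ := h
  obtain ⟨g, hg, hglap, hgexp⟩ := exists_harmonic_cap c j
  obtain ⟨b, hb⟩ := exists_orthonormalBasis_third P
  set K : ℝ := (1 + Real.exp T ^ 2) ^ 2 / 4 with hK
  have hq : ∀ {x : S2}, x ≠ -P → 1 + 1 * ⟪b 2, (x : E3)⟫ ≠ 0 := fun {x} hx h0 =>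
    hx (eq_neg_of_inner_eq_neg_one (by rwa [hb, one_mul] at h0))
  have hq' : ∀ {x : S2}, x ≠ P → 1 + -1 * ⟪b 2, (x : E3)⟫ ≠ 0 := fun {x} hx h0 =>
    hx (eq_of_inner_eq_one (by rw [← hb]; linarith))
  have hPne : P ≠ -P := by
    intro h0
    have h1 : (P : E3) = -(P : E3) := congrArg Subtype.val h0
    have h2 : ⟪(P : E3), (P : E3)⟫ = 1 := by
      rw [real_inner_self_eq_norm_sq, norm_eq_of_mem_sphere P, one_pow]
    have h3 : ⟪(P : E3), (P : E3)⟫ = -1 := by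
      nth_rewrite 2 [h1]
      rw [inner_neg_right, h2]
    linarith
  have hZP : stereo b 1 P = 0 := by
    have := norm_sq_stereo b (σ := 1) (by norm_num) P (hq hPne)
    rw [hb, real_inner_self_eq_norm_sq, norm_eq_of_mem_sphere P] at this
    have h0 : ‖stereo b 1 P‖ ^ 2 = 0 := by linarith
    exact norm_eq_zero.1 (pow_eq_zero_iff two_ne_zero |>.1 h0)
  have hZQ : stereo b (-1) (-P : S2) = 0 := by
    have hin : ⟪b 2, ((-P : S2) : E3)⟫ = -1 := by
      have : ((-P : S2) : E3) = -(P : E3) := rfl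
      rw [this, hb, inner_neg_right, real_inner_self_eq_norm_sq, norm_eq_of_mem_sphere P, one_pow]
    have := norm_sq_stereo b (σ := -1) (by norm_num) (-P) (hq' hPne.symm)
    rw [hin] at this
    have h0 : ‖stereo b (-1) (-P : S2)‖ ^ 2 = 0 := by linarith
    exact norm_eq_zero.1 (pow_eq_zero_iff two_ne_zero |>.1 h0)
  -- the two stereographic coordinates in terms of the cylindrical one
  have hinv : ∀ {x : S2}, x ≠ P → x ≠ -P → stereo b 1 x ≠ 0 ∧
      stereo b (-1) x = Complex.exp (-conj (Complex.log (stereo b 1 x))) := by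
    intro x h1 h2
    have hmul := stereo_neg_mul_conj b x (by simpa using hq h2) (by
      have := hq' h1
      rwa [neg_one_mul, ← sub_eq_add_neg] at this)
    have hne : stereo b 1 x ≠ 0 := by
      intro h0
      rw [h0, map_zero, mul_zero] at hmul
      exact zero_ne_one hmul
    refine ⟨hne, ?_⟩
    rw [Complex.exp_neg, Complex.exp_conj, Complex.exp_log hne]
    exact eq_inv_of_mul_eq_one_left hmul
  -- the values at `±P` are prescribed, since `Complex.log` has a junk value there
  set u : S2 → ℂ := fun x => open Classical in
    if x = P then 0 else if x = -P then g 0 else U (Complex.log (stereo b 1 x)) with hu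
  have uP : u P = 0 := by simp [hu]
  have uQ : u (-P) = g 0 := by simp [hu, hPne.symm]
  have uc : ∀ {x : S2}, x ≠ P → x ≠ -P → u x = U (Complex.log (stereo b 1 x)) := by
    intro x h1 h2
    simp [hu, h1, h2]
  have cont : ∀ {σ : ℝ} {x : S2}, 1 + σ * ⟪b 2, (x : E3)⟫ ≠ 0 →
      ContinuousAt (fun z : S2 => stereo b σ z) x := by
    intro σ x hx
    have h1 := (contDiffAt_stereo b σ (ne_zero_of_mem_unit_sphere x)
      (by rwa [norm_eq_of_mem_sphere x])).continuousAt
    exact ContinuousAt.comp (f := ((↑) : S2 → E3)) h1 continuous_subtype_val.continuousAt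
  have ne_ev : ∀ {x y : S2}, x ≠ y → ∀ᶠ z : S2 in 𝓝 x, z ≠ y := fun h => isOpen_ne.mem_nhds h
  -- near `P`
  have nearP : ∀ {x : S2}, x ≠ -P → ‖stereo b 1 x‖ < 1 →
      ∀ᶠ z : S2 in 𝓝 x, u z = conj (stereo b 1 z ^ N) := by
    intro x hx hx1
    filter_upwards [ne_ev hx, (cont (hq hx)).norm.eventually (gt_mem_nhds hx1)] with z hz hz1
    by_cases hzP : z = P
    · rw [hzP, uP, hZP, zero_pow (by omega), map_zero]
    · obtain ⟨hne, -⟩ := hinv hzP hz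
      rw [uc hzP hz, hstart, map_pow]
      · rw [Complex.exp_nat_mul, Complex.exp_conj, Complex.exp_log hne]
      · rw [Complex.log_re]
        exact Real.log_nonpos (norm_nonneg _) hz1.le
  -- near `-P`
  have nearQ : ∀ {x : S2}, x ≠ P → ‖stereo b (-1) x‖ < Real.exp (-T) →
      ∀ᶠ z : S2 in 𝓝 x, u z = g (stereo b (-1) z) := by
    intro x hx hx1
    filter_upwards [ne_ev hx, (cont (hq' hx)).norm.eventually (gt_mem_nhds hx1)] with z hz hz1
    by_cases hzQ : z = -P
    · rw [hzQ, uQ, hZQ]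
    · obtain ⟨hne, heq⟩ := hinv hz hzQ
      rw [uc hz hzQ, hend, heq, hgexp]
      rw [heq, Complex.norm_exp, Real.exp_lt_exp] at hz1
      simp only [Complex.neg_re, Complex.conj_re] at hz1
      linarith
  have hpowC : ContDiff ℝ 2 fun z : ℂ => z ^ N := contDiff_id.pow N
  have hconjC : ContDiff ℝ 2 fun z : ℂ => conj (z ^ N) := Complex.conjCLE.contDiff.comp hpowC
  have locP : ∀ {x : S2}, x ≠ -P → ‖stereo b 1 x‖ < 1 →
      ContDiffAt ℝ 2 (homogExt u) x ∧ sphereLaplacian u x = 0 := by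
    intro x hx hx1
    obtain ⟨h1, h2⟩ := sphere_local_form b (σ := 1) (by norm_num) (hq hx) hconjC.contDiffAt
      (nearP hx hx1)
    refine ⟨h1, ?_⟩
    rw [h2, laplacian_conj_comp hpowC.contDiffAt, laplacian_eq_zero_of_analyticAt (by fun_prop),
      map_zero, mul_zero]
  have locQ : ∀ {x : S2}, x ≠ P → ‖stereo b (-1) x‖ < Real.exp (-T) →
      ContDiffAt ℝ 2 (homogExt u) x ∧ sphereLaplacian u x = 0 := by
    intro x hx hx1
    obtain ⟨h1, h2⟩ := sphere_local_form b (σ := -1) (by norm_num) (hq' hx) hg.contDiffAt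
      (nearQ hx hx1)
    exact ⟨h1, by rw [h2, hglap, mul_zero]⟩
  have locC : ∀ {x : S2}, x ≠ P → x ≠ -P → ContDiffAt ℝ 2 (homogExt u) x ∧
      ‖sphereLaplacian u x‖ ≤ ((1 + 1 * ⟪b 2, (x : E3)⟫) ^ 2)⁻¹ * (‖stereo b 1 x‖⁻¹ ^ 2) *
        (A * ‖u x‖) := by
    intro x h1 h2
    obtain ⟨hne, -⟩ := hinv h1 h2
    obtain ⟨ℓ, hℓ, hℓ0, hℓd, hℓU⟩ := exists_local_log hper hne
    have hUC : ContDiffAt ℝ 2 (U ∘ ℓ) (stereo b 1 x) :=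
      hU.contDiffAt.comp _ ((hℓ.contDiffAt (n := 2)).restrict_scalars ℝ)
    have hev : ∀ᶠ z : S2 in 𝓝 x, u z = (U ∘ ℓ) (stereo b 1 z) := by
      filter_upwards [ne_ev h1, ne_ev h2, (cont (hq h2)).eventually hℓU] with z hz1 hz2 hz
      rw [uc hz1 hz2, hz, Function.comp_apply]
    obtain ⟨c1, c2⟩ := sphere_local_form b (σ := 1) (by norm_num) (hq h2) hUC hev
    refine ⟨c1, ?_⟩
    rw [c2, laplacian_comp_of_analyticAt hℓ hU.contDiffAt, hℓd, hℓ0, norm_mul, norm_mul,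
      Complex.norm_real, Complex.norm_real, norm_inv, Real.norm_of_nonneg (by positivity),
      Real.norm_of_nonneg (by positivity), uc h1 h2, mul_assoc]
    rw [norm_inv (stereo b 1 x)]
    gcongr
    exact hbound _
  have hC2 : ∀ x : S2, ContDiffAt ℝ 2 (homogExt u) x := by
    intro x
    by_cases h1 : x = P
    · rw [h1]
      exact (locP hPne (by rw [hZP, norm_zero]; exact one_pos)).1
    by_cases h2 : x = -P
    · rw [h2]
      exact (locQ hPne.symm (by rw [hZQ, norm_zero]; exact Real.exp_pos _)).1
    exact (locC h1 h2).1
  have hbd : ∀ x : S2, ‖sphereLaplacian u x‖ ≤ K * A * ‖u x‖ := by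
    intro x
    have hnn : 0 ≤ K * A * ‖u x‖ := by positivity
    by_cases h1 : x = P
    · rw [h1] at hnn ⊢
      rwa [(locP hPne (by rw [hZP, norm_zero]; exact one_pos)).2, norm_zero]
    by_cases h2 : x = -P
    · rw [h2] at hnn ⊢
      rwa [(locQ hPne.symm (by rw [hZQ, norm_zero]; exact Real.exp_pos _)).2, norm_zero]
    rcases lt_or_ge ‖stereo b 1 x‖ 1 with h3 | h3
    · rwa [(locP h2 h3).2, norm_zero]
    rcases lt_or_ge ‖stereo b (-1) x‖ (Real.exp (-T)) with h4 | h4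
    · rwa [(locQ h1 h4).2, norm_zero]
    obtain ⟨hne, heq⟩ := hinv h1 h2
    -- on the remaining band the conformal factor is bounded
    have h5 : ‖stereo b 1 x‖ ≤ Real.exp T := by
      rw [heq, Complex.norm_exp, Real.exp_le_exp] at h4
      simp only [Complex.neg_re, Complex.conj_re, Complex.log_re] at h4
      rw [← Real.exp_log (by linarith : 0 < ‖stereo b 1 x‖)]
      exact Real.exp_le_exp.2 (by linarith)
    have h6 := norm_sq_stereo b (σ := 1) (by norm_num) x (hq h2)
    set R := ‖stereo b 1 x‖
    have h7 : (1 + 1 * ⟪b 2, (x : E3)⟫)⁻¹ = (1 + R ^ 2) / 2 := by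
      rw [inv_eq_iff_eq_inv, inv_div, eq_div_iff (by positivity)]
      linarith
    refine (locC h1 h2).2.trans ?_
    rw [mul_assoc K]
    gcongr
    rw [← inv_pow, h7, hK]
    calc ((1 + R ^ 2) / 2) ^ 2 * R⁻¹ ^ 2 ≤ ((1 + Real.exp T ^ 2) / 2) ^ 2 * 1 := by
          gcongr
          exact pow_le_one₀ (by positivity) (inv_le_one_of_one_le₀ h3)
      _ = _ := by ring
  set W : S2 → ℂ := fun x => -(sphereLaplacian u x / u x) with hW
  have hWbd : ∀ x, ‖W x‖ ≤ K * A := by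
    intro x
    simp only [hW]
    rw [norm_neg, norm_div]
    exact div_le_of_le_mul₀ (norm_nonneg _) (by positivity) (hbd x)
  have hsmooth := contMDiff_of_homogExt hC2
  have hWm : Measurable W :=
    ((continuous_sphereLaplacian hC2).measurable.div hsmooth.continuous.measurable).neg
  refine ⟨W, u, memLp_top_of_bound hWm.aestronglyMeasurable (K * A) (ae_of_all _ hWbd), ?_, hsmooth,
    fun x => ?_, ?_, HasCompactSupport.of_compactSpace W, ?_⟩
  · rw [eLpNorm_exponent_top]
    exact ENNReal.toReal_le_of_le_ofReal (by positivity)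
      (eLpNormEssSup_le_of_ae_bound (ae_of_all _ hWbd))
  · by_cases h0 : u x = 0
    · have := hbd x
      rw [h0, norm_zero, mul_zero] at this
      rw [h0, mul_zero, add_zero, norm_le_zero_iff.1 this]
    · simp only [hW]
      field_simp
      ring
  · refine vanishesWithOrder_of_norm_eq b hb ?_
    filter_upwards [nearP hPne (by rw [hZP, norm_zero]; exact one_pos)] with x hx
    rw [hx, Complex.norm_conj, norm_pow]
  · intro x hx hxPQ
    revert hx
    rw [imp_false, notMem_tsupport_iff_eventuallyEq]
    rcases hxPQ with rfl | hxQ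
    · filter_upwards [ne_ev hPne, (cont (hq hPne)).norm.eventually
        (gt_mem_nhds (by rw [hZP, norm_zero]; exact one_pos : ‖stereo b 1 x‖ < 1))] with z h1 h2
      simp [hW, (locP h1 h2).2]
    · rw [Set.mem_singleton_iff.1 hxQ]
      filter_upwards [ne_ev hPne.symm, (cont (hq' hPne.symm)).norm.eventually
        (gt_mem_nhds (by rw [hZQ, norm_zero]; exact Real.exp_pos _ :
          ‖stereo b (-1) (-P : S2)‖ < Real.exp (-T)))] with z h1 h2
      simp [hW, (locQ h1 h2).2]

theorem theorem2 :
    ∃ C : ℝ, 0 < C ∧ ∃ N₀ : ℕ, ∀ N : ℕ, N₀ ≤ N → ∀ P : S2,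
      ∃ (W u : S2 → ℂ),
        MemLp W ⊤ surfaceMeasure ∧
        C * (eLpNorm W ⊤ surfaceMeasure).toReal ^ ((2 : ℝ) / 3) ≤ (N : ℝ) ∧
        ContMDiff (𝓡 2) 𝓘(ℝ, ℂ) 2 u ∧
        (∀ x : S2, sphereLaplacian u x + W x * u x = 0) ∧
        VanishesWithOrder u P N ∧
        HasCompactSupport W ∧ tsupport W ⊆ ({P, -P} : Set S2)ᶜ := by
  obtain ⟨A, hA, hbridge⟩ := exists_bridge
  set D : ℝ := (1 + Real.exp 10 ^ 2) ^ 2 / 4 * A with hD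
  have hD0 : 0 < D := by positivity
  refine ⟨(4 * D ^ ((2 : ℝ) / 3))⁻¹, by positivity, 1, fun N hN P => ?_⟩
  -- `k ^ 2` is the first square above `N`, so that `k ≤ 2 √N`
  set k := N.sqrt + 1 with hk
  have hkN : N ≤ k ^ 2 := by
    rw [sq]
    exact (Nat.lt_succ_sqrt N).le
  have hk4 : k ^ 2 ≤ 4 * N := by
    have h1 : N.sqrt * N.sqrt ≤ N := Nat.sqrt_le N
    have h2 : 1 ≤ N.sqrt := Nat.sqrt_pos.2 hN
    rw [hk]
    nlinarith
  obtain ⟨W, u, h1, h2, h3⟩ := exists_solution_of_hasBridge (by positivity) hN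
    (hbridge N k (Nat.succ_pos _) hkN) P
  refine ⟨W, u, h1, ?_, h3⟩
  have hk4R : (k : ℝ) ^ 2 ≤ 4 * N := by exact_mod_cast hk4
  have h4 : (eLpNorm W ⊤ surfaceMeasure).toReal ^ ((2 : ℝ) / 3) ≤ D ^ ((2 : ℝ) / 3) * (4 * N) := by
    calc _ ≤ (D * (k : ℝ) ^ 3) ^ ((2 : ℝ) / 3) := by
          refine Real.rpow_le_rpow ENNReal.toReal_nonneg (h2.trans_eq ?_) (by norm_num)
          rw [hD]
          ring
      _ = D ^ ((2 : ℝ) / 3) * (k : ℝ) ^ 2 := by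
          rw [Real.mul_rpow hD0.le (by positivity), ← Real.rpow_natCast (k : ℝ) 3, ← Real.rpow_mul
            (by positivity)]
          norm_num
      _ ≤ _ := by gcongr
  rw [inv_mul_le_iff₀ (by positivity)]
  linarith
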